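/- **Model.** In the plane, macro base stations (MBSs, tier $m$) and small-cell base stations (SBSs, tier $s$) are located at the points $x_{i,j}$, $j\in\mathbb N$, of independent homogeneous Poisson point processes with densities $\lambda_m,\lambda_s>0$, and transmit with powers $P_m,P_s>0$. The channel power gains $h_{i,j}$ are i.i.d. exponential variables of mean $1$ (Rayleigh fading), independent of all the locations; the path loss exponent is $\alpha>2$. A user is at the origin; let $r_i$ be the distance to its nearest BS of tier $i\in\{m,s\}$. The user is served by the BS with the largest average received signal strength, that is, by the nearest MBS if $P_mr_m^{-\alpha}>P_sr_s^{-\alpha}$ (event $A_m$) and by the nearest SBS otherwise (event $A_s$). Given $A_i$, the serving distance is $R=r_i$, the interference is $I=\sum P_{k}h_{k,l}\|x_{k,l}\|^{-\alpha}$ over all BSs $(k,l)$ of both tiers except the serving one, and, with $\sigma^2\ge 0$ the noise variance and $h$ the gain of the serving BS, $\mathrm{SINR}=P_i h R^{-\alpha}/(I+\sigma^2)$. For a threshold $\theta>0$ the coverage probability is $\mathcal P_n(A_i)=\mathbb P(\mathrm{SINR}>\theta\mid A_i)$. **Theorem.** Put $p_s=\bigl(1+\tfrac{\lambda_m}{\lambda_s}(P_m/P_s)^{2/\alpha}\bigr)^{-1}$,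 $\omega=\sqrt{P_m/P_s}$, and for $r>0$ $$f_{m}(r)=\frac{2\pi\lambda_m r}{1-p_s}e^{-\pi r^2(\lambda_m+\lambda_s(P_s/P_m)^{2/\alpha})},\qquad f_{s}(r)=\frac{2\pi\lambda_s r}{p_s}e^{-\pi r^2(\lambda_s+\lambda_m(P_m/P_s)^{2/\alpha})}.$$ Then $\mathbb P(A_s)=p_s$, $\mathbb P(A_m)=1-p_s$, and for each $i\in\{m,s\}$: 1. conditionally on $A_i$, the serving distance has density $f_i$ on $(0,\infty)$; 2. the interference is almost surely finite, and for every $s>0$ its conditional Laplace transform given $A_i$ and the serving distance $r$ is $$\mathcal L_I(s)=\mathbb E\bigl[e^{-sI}\mid A_i,\,R=r\bigr]=\prod_{k\in\{s,m\}}\exp\Bigl(-2\pi\lambda_k(sP_k)^{2/\alpha}F\bigl((sP_k)^{-1/\alpha}d_k,\alpha\bigr)\Bigr),\qquad F(y,\alpha)=\int_y^\infty\frac{\mu}{1+\mu^\alpha}\,d\mu,$$ where $d_m=r$, $d_s=\omega^{-2/\alpha}r$ if $i=m$, and $d_m=\omega^{2/\alpha}r$, $d_s=r$ if $i=s$; 3.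 the coverage probability is given by the convergent integral $$\mathcal P_n(A_i)=\int_0^\infty e^{-P_i^{-1}\theta r^\alpha\sigma^2}\,\mathcal L_I\bigl(P_i^{-1}\theta r^\alpha\bigr)\,f_i(r)\,dr .$$ -/

import Mathlib

open MeasureTheory ProbabilityTheory Set
open scoped NNReal ENNReal

/-- The two tiers of base stations (BSs): macrocell BSs (MBSs) and small-cell BSs (SBSs). -/
inductive Tier where
  | mbs
  | sbs
  deriving DecidableEq

instance : Fintype Tier := ⟨{.mbs, .sbs}, fun t => by cases t <;> simp⟩

namespace TwoTier

/-- The plane in which the BSs are located; the typical user sits at the origin. -/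
abbrev Plane : Type := EuclideanSpace ℝ (Fin 2)

section Model

variable {Ω : Type*}

/-- The number of points (with multiplicity) of the random sequence `x` lying in `B`. -/
noncomputable def numPoints (x : ℕ → Ω → Plane) (B : Set Plane) (ω : Ω) : ℝ≥0∞ :=
  ∑' j, B.indicator (fun _ => (1 : ℝ≥0∞)) (x j ω)

/-- The random points `x 0, x 1, …` form a homogeneous Poisson point process of density `lam`:
the number of points in a Borel set `B` of finite area is Poisson with mean `lam * area B`, and
the numbers of points in pairwise disjoint Borel sets are independent. -/
structure IsHomogeneousPPP [MeasurableSpace Ω] (μ : Measure Ω) (lam : ℝ)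
    (x : ℕ → Ω → Plane) : Prop where
  poisson_count : ∀ B : Set Plane, MeasurableSet B → volume B < ∞ →
    μ.map (numPoints x B) =
      (poissonMeasure (lam * volume.real B).toNNReal).map (fun n : ℕ => (n : ℝ≥0∞))
  indep_count : ∀ (n : ℕ) (B : Fin n → Set Plane), (∀ k, MeasurableSet (B k)) →
    Pairwise (fun k l => Disjoint (B k) (B l)) → iIndepFun (fun k => numPoints x (B k)) μ

/-- The probabilistic model: `x i j` is the location of the `j`-th BS of tier `i` (in an arbitrary
enumeration) and `h i j` its channel power gain. The two tiers are independent homogeneous Poisson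
point processes with densities `lam i`; the gains are independent standard exponential variables
(Rayleigh fading), independent of all the locations. -/
structure IsTwoTierNetwork [MeasurableSpace Ω] (μ : Measure Ω) (lam : Tier → ℝ)
    (x : Tier → ℕ → Ω → Plane) (h : Tier → ℕ → Ω → ℝ) : Prop where
  measurable_location : ∀ i j, Measurable (x i j)
  measurable_gain : ∀ i j, Measurable (h i j)
  poisson : ∀ i, IsHomogeneousPPP μ (lam i) (x i)
  indep_tiers : IndepFun (fun ω j => x .mbs j ω) (fun ω j => x .sbs j ω) μ
  gain_law : ∀ i j, μ.map (h i j) = expMeasure 1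
  indep_gain : iIndepFun (fun k : Tier × ℕ => h k.1 k.2) μ
  indep_location_gain : IndepFun (fun ω i j => x i j ω) (fun ω i j => h i j ω) μ

/-- The index of the BS of tier `i` nearest to the user (the least such index; almost surely there
is exactly one). -/
noncomputable def nearestIdx (x : Tier → ℕ → Ω → Plane) (i : Tier) (ω : Ω) : ℕ :=
  sInf {j | ∀ k, ‖x i j ω‖ ≤ ‖x i k ω‖}

/-- The distance from the user to the nearest BS of tier `i`. -/
noncomputable def nearestDist (x : Tier → ℕ → Ω → Plane) (i : Tier) (ω : Ω) : ℝ :=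
  ‖x i (nearestIdx x i ω) ω‖

/-- The received signal strength (averaged over fading) from the nearest BS of tier `i`. -/
noncomputable def rss (α : ℝ) (P : Tier → ℝ) (x : Tier → ℕ → Ω → Plane) (i : Tier) (ω : Ω) : ℝ :=
  P i * nearestDist x i ω ^ (-α)

/-- The event that the user is served by tier `i` under max-RSS association. Since all BSs of one
tier transmit at the same power, the strongest BS is the nearest BS of one of the two tiers. -/
def association (α : ℝ) (P : Tier → ℝ) (x : Tier → ℕ → Ω → Plane) : Tier → Set Ω
  | .mbs => {ω | rss α P x .sbs ω < rss α P x .mbs ω}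
  | .sbs => {ω | rss α P x .mbs ω ≤ rss α P x .sbs ω}

/-- The instantaneous power received by the user from the `j`-th BS of tier `i`. -/
noncomputable def receivedPower (α : ℝ) (P : Tier → ℝ) (x : Tier → ℕ → Ω → Plane)
    (h : Tier → ℕ → Ω → ℝ) (i : Tier) (j : ℕ) (ω : Ω) : ℝ :=
  P i * h i j ω * ‖x i j ω‖ ^ (-α)

/-- The interference at a user served by the nearest BS of tier `i`: the total power received from
all the other BSs of both tiers. -/
noncomputable def interference (α : ℝ) (P : Tier → ℝ) (x : Tier → ℕ → Ω → Plane)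
    (h : Tier → ℕ → Ω → ℝ) (i : Tier) (ω : Ω) : ℝ≥0∞ :=
  ∑' k : Tier × ℕ, if k = (i, nearestIdx x i ω) then 0
    else ENNReal.ofReal (receivedPower α P x h k.1 k.2 ω)

/-- The SINR of a user served by the nearest BS of tier `i`, with noise variance `σ ^ 2`. -/
noncomputable def sinr (α σ : ℝ) (P : Tier → ℝ) (x : Tier → ℕ → Ω → Plane)
    (h : Tier → ℕ → Ω → ℝ) (i : Tier) (ω : Ω) : ℝ≥0∞ :=
  ENNReal.ofReal (receivedPower α P x h i (nearestIdx x i ω) ω) /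
    (interference α P x h i ω + ENNReal.ofReal (σ ^ 2))

/-- The coverage probability of a user served by tier `i`: the conditional probability, given that
the user is associated with tier `i`, that the SINR exceeds the threshold `θ`. -/
noncomputable def coverageProb [MeasurableSpace Ω] (μ : Measure Ω) (α σ θ : ℝ) (P : Tier → ℝ)
    (x : Tier → ℕ → Ω → Plane) (h : Tier → ℕ → Ω → ℝ) (i : Tier) : ℝ :=
  (μ[|association α P x i]).real {ω | ENNReal.ofReal θ < sinr α σ P x h i ω}

end Model

/-- The closed form of the probability of association with the SBS tier. -/
noncomputable def sbsProb (α : ℝ) (lam P : Tier → ℝ) : ℝ :=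
  1 / (1 + lam .mbs / lam .sbs * (P .mbs / P .sbs) ^ (2 / α))

/-- The closed forms of the serving-distance densities, given association with each tier. -/
noncomputable def servingDensity (α : ℝ) (lam P : Tier → ℝ) : Tier → ℝ → ℝ
  | .mbs, r => 2 * Real.pi * lam .mbs * r / (1 - sbsProb α lam P) *
      Real.exp (-Real.pi * r ^ 2 * (lam .mbs + lam .sbs * (P .sbs / P .mbs) ^ (2 / α)))
  | .sbs, r => 2 * Real.pi * lam .sbs * r / sbsProb α lam P *
      Real.exp (-Real.pi * r ^ 2 * (lam .sbs + lam .mbs * (P .mbs / P .sbs) ^ (2 / α)))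

/-- The square root of the ratio of the MBS and SBS transmit powers. -/
noncomputable def omegaRatio (P : Tier → ℝ) : ℝ := √(P .mbs / P .sbs)

/-- `exclusionRadius α P i r i'` is the radius around the user inside which there is no interfering
BS of tier `i'`, when the user is served by a BS of tier `i` at distance `r`. -/
noncomputable def exclusionRadius (α : ℝ) (P : Tier → ℝ) : Tier → ℝ → Tier → ℝ
  | .mbs, r, .mbs => r
  | .mbs, r, .sbs => omegaRatio P ^ (-2 / α) * r
  | .sbs, r, .mbs => omegaRatio P ^ (2 / α) * r
  | .sbs, r, .sbs => r

/-- The function `F(y, α) = ∫_y^∞ u / (1 + u ^ α) du`. -/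
noncomputable def tailIntegral (y α : ℝ) : ℝ := ∫ u in Ioi y, u / (1 + u ^ α)

/-- The closed form of the Laplace transform at `s` of the interference, with exclusion radii
`d i`. -/
noncomputable def laplaceFormula (α : ℝ) (lam P : Tier → ℝ) (d : Tier → ℝ) (s : ℝ) : ℝ :=
  ∏ i : Tier, Real.exp (-2 * Real.pi * lam i * (s * P i) ^ (2 / α) *
    tailIntegral ((s * P i) ^ (-1 / α) * d i) α)

/-- The integrand in the coverage probability of a user served by tier `i`, at distance `r`. -/
noncomputable def coverageIntegrand (α σ θ : ℝ) (lam P : Tier → ℝ) (i : Tier) (r : ℝ) : ℝ :=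
  Real.exp (-(P i)⁻¹ * θ * r ^ α * σ ^ 2) *
    laplaceFormula α lam P (exclusionRadius α P i r) ((P i)⁻¹ * θ * r ^ α) *
    servingDensity α lam P i r

end TwoTier

/-! Everything reduces to the Laplace functional of a Poisson process, `E exp(-∑ g(x_j)) = exp(-λ ∫
(1 - exp(-g)))`, for `g` with values in `[0, ∞]` (`lintegral_expNeg_tsum`). Averaging an exponential
gain gives `E exp(-b h) = 1 / (1 + b) = exp(-log (1 + b))`. Hence, with the locations frozen, the
average of `exp(-s I)` is again the exponential of a sum over points, of `log (1 + s P ‖x‖ ^ (-α))`.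

The value `∞` encodes empty discs. If `g = ∞` on the disc of radius `d` and `g = log (1 + c r ^
(-α))` outside, the functional is `E[1{R > d} exp(-∑ g)] = exp(-Λ(d))`, where `R` is the distance to
the nearest point and `Λ` is `laplaceExponent`. Differentiation in `d` gives the law of `R` weighted
by all points. Cancelling the factor `1 / (1 + c R ^ (-α))` of the nearest point leaves the weight
of the other points alone, with density `2πλ r exp(-Λ(r))` (`lintegral_nearestDist_mul_expNeg`).
This takes the place of Palm calculus.

Up to null sets, association with tier `i` says that the other tier `k` has no point within `a R_i`,
for an explicit ratio `a`. With tier `i` frozen this is another empty disc and contributes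
`exp(-Λ_k(a r))`. The product `2πλ_i r exp(-Λ_i(r)) exp(-Λ_k(a r))` regroups as association
probability times `laplaceFormula` times `servingDensity`. The resulting identity,
`setLIntegral_association_interference`, yields the association probabilities and the distance law
at `s = 0`, and the conditional Laplace transform for `s > 0`.

For coverage, the serving gain is independent of the interference given the locations, so `P(h > Y)
= E exp(-Y)` with `Y = θ R ^ α (I + σ ^ 2) / P_i`. Here the Laplace argument depends on `R`; it is
approximated by functions of `R` with countably many values (`lintegral_cond_interference_comp`). -/

namespace TwoTier

open Filter Topology

/-! ### The exponential on `[0, ∞]` and the Poisson generating function -/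

/-- The function `y ↦ e^{-y}` on `[0, ∞]`, with `e^{-∞} = 0`. -/
noncomputable def expNeg (y : ℝ≥0∞) : ℝ≥0∞ := EReal.exp (-(y : EReal))

@[simp] lemma expNeg_zero : expNeg 0 = 1 := by simp [expNeg]

@[simp] lemma expNeg_top : expNeg ∞ = 0 := by simp [expNeg]

lemma expNeg_add (a b : ℝ≥0∞) : expNeg (a + b) = expNeg a * expNeg b := by
  rw [expNeg, expNeg, expNeg, ← EReal.exp_add, EReal.coe_ennreal_add, EReal.neg_add,
    sub_eq_add_neg] <;> simp

lemma expNeg_sum {ι : Type*} (s : Finset ι) (f : ι → ℝ≥0∞) :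
    expNeg (∑ i ∈ s, f i) = ∏ i ∈ s, expNeg (f i) := by
  classical
  induction s using Finset.induction_on with
  | empty => simp
  | insert i s hi ih => rw [Finset.sum_insert hi, Finset.prod_insert hi, expNeg_add, ih]

lemma antitone_expNeg : Antitone expNeg := fun a b hab => by
  simpa [expNeg] using hab

lemma expNeg_le_one (y : ℝ≥0∞) : expNeg y ≤ 1 := by
  simpa using antitone_expNeg (zero_le (a := y))

lemma expNeg_ne_top (y : ℝ≥0∞) : expNeg y ≠ ∞ := ((expNeg_le_one y).trans_lt (by simp)).ne

lemma continuous_expNeg : Continuous expNeg :=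
  ENNReal.continuous_exp.comp (continuous_neg.comp continuous_coe_ennreal_ereal)

@[fun_prop]
lemma measurable_expNeg : Measurable expNeg := continuous_expNeg.measurable

lemma expNeg_ofReal {y : ℝ} (hy : 0 ≤ y) :
    expNeg (ENNReal.ofReal y) = ENNReal.ofReal (Real.exp (-y)) := by
  rw [expNeg, EReal.coe_ennreal_ofReal, max_eq_left hy, ← EReal.coe_neg, EReal.exp_coe]

lemma expNeg_ofReal_log {y : ℝ} (hy : 1 ≤ y) :
    expNeg (ENNReal.ofReal (Real.log y)) = ENNReal.ofReal y⁻¹ := by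
  rw [expNeg_ofReal (Real.log_nonneg hy), Real.exp_neg, Real.exp_log (by linarith)]

/-- The generating function `E q ^ N = exp(-r (1 - q))` at `q = exp(-c)`. The case `c = ∞`, `q = 0`
is included: as `∞ * 0 = 0`, the left side is then the probability of `N = 0`. -/
lemma lintegral_expNeg_poissonMeasure (r : ℝ≥0) (c : ℝ≥0∞) :
    ∫⁻ n : ℕ, expNeg (c * n) ∂poissonMeasure r = expNeg (r * (1 - expNeg c)) := by
  obtain ⟨q, hq0, hq1, hq⟩ : ∃ q : ℝ, 0 ≤ q ∧ q ≤ 1 ∧ expNeg c = ENNReal.ofReal q :=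
    ⟨(expNeg c).toReal, ENNReal.toReal_nonneg, ENNReal.toReal_le_of_le_ofReal zero_le_one
      (by simpa using expNeg_le_one c), (ENNReal.ofReal_toReal (expNeg_ne_top c)).symm⟩
  have hpow (n : ℕ) : expNeg (c * n) = ENNReal.ofReal (q ^ n) := by
    rw [ENNReal.ofReal_pow hq0, ← hq, mul_comm, ← nsmul_eq_mul]
    simpa using expNeg_sum (Finset.range n) (fun _ => c)
  have hs : HasSum (fun n : ℕ => Real.exp (-r) * r ^ n / n.factorial * q ^ n)
      (Real.exp (-(r * (1 - q)))) := by
    have := (NormedSpace.expSeries_div_hasSum_exp ((r : ℝ) * q)).mul_left (Real.exp (-r))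
    rw [← Real.exp_eq_exp_ℝ, ← Real.exp_add] at this
    convert! this using 1
    · ext n; rw [mul_pow]; ring
    · ring_nf
  rw [hq, ← ENNReal.ofReal_one, ← ENNReal.ofReal_sub _ hq0, ← ENNReal.ofReal_coe_nnreal,
    ← ENNReal.ofReal_mul r.coe_nonneg, expNeg_ofReal (mul_nonneg r.coe_nonneg (by linarith)),
    ← hs.tsum_eq, ENNReal.ofReal_tsum_of_nonneg (fun n => by positivity) hs.summable, poissonMeasure,
    lintegral_sum_measure]
  refine tsum_congr fun n => ?_
  rw [lintegral_smul_measure, lintegral_dirac, hpow, smul_eq_mul,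
    ENNReal.ofReal_mul (by positivity)]

/-! ### Laplace functional of a Poisson process -/

section PointProcess

variable {Ω : Type*} [MeasurableSpace Ω] {μ : Measure Ω} {lam : ℝ} {x : ℕ → Ω → Plane}

lemma measurable_numPoints (hx : ∀ j, Measurable (x j)) {B : Set Plane} (hB : MeasurableSet B) :
    Measurable (numPoints x B) :=
  Measurable.tsum fun j => (measurable_const.indicator hB).comp (hx j)

lemma lintegral_expNeg_mul_numPoints (hx : ∀ j, Measurable (x j)) (hppp : IsHomogeneousPPP μ lam x)
    {B : Set Plane} (hB : MeasurableSet B) (hB' : volume B < ∞) (c : ℝ≥0∞) :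
    ∫⁻ ω, expNeg (c * numPoints x B ω) ∂μ =
      expNeg (ENNReal.ofReal lam * (volume B * (1 - expNeg c))) := by
  have hm : Measurable fun y : ℝ≥0∞ => expNeg (c * y) := by fun_prop
  rw [← lintegral_map (f := fun y => expNeg (c * y)) hm (measurable_numPoints hx hB),
    hppp.poisson_count B hB hB', lintegral_map hm .of_discrete, lintegral_expNeg_poissonMeasure,
    ← mul_assoc]
  congr 2
  rw [← ENNReal.ofReal, ENNReal.ofReal_mul' measureReal_nonneg, ofReal_measureReal hB'.ne]

/-- For a step function, the sum over points is a combination of independent Poisson counts.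
Disjointness leaves at most one nonzero term at each `z`, which makes `1 - exp(-·)` additive over
the pieces. -/
lemma lintegral_expNeg_tsum_sum_indicator (hx : ∀ j, Measurable (x j))
    (hppp : IsHomogeneousPPP μ lam x) {n : ℕ} (c : Fin n → ℝ≥0∞) (B : Fin n → Set Plane)
    (hB : ∀ k, MeasurableSet (B k)) (hB' : ∀ k, volume (B k) < ∞)
    (hd : Pairwise fun k l => Disjoint (B k) (B l)) :
    ∫⁻ ω, expNeg (∑' j, ∑ k, (B k).indicator (fun _ => c k) (x j ω)) ∂μ =
      expNeg (ENNReal.ofReal lam *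
        ∫⁻ z, (1 - expNeg (∑ k, (B k).indicator (fun _ => c k) z))) := by
  have h1 (ω : Ω) : expNeg (∑' j, ∑ k, (B k).indicator (fun _ => c k) (x j ω)) =
      ∏ k, expNeg (c k * numPoints x (B k) ω) := by
    rw [Summable.tsum_finsetSum fun _ _ => ENNReal.summable, expNeg_sum]
    refine Finset.prod_congr rfl fun k _ => ?_
    rw [numPoints, ← ENNReal.tsum_mul_left]
    congr 2 with j
    by_cases h : x j ω ∈ B k <;> simp [h]
  have h2 (z : Plane) : 1 - expNeg (∑ k, (B k).indicator (fun _ => c k) z) =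
      ∑ k, (B k).indicator (fun _ => 1 - expNeg (c k)) z := by
    by_cases hz : ∃ k, z ∈ B k
    · obtain ⟨k, hk⟩ := hz
      have hne (l : Fin n) (hl : l ≠ k) : z ∉ B l := fun h => (hd hl).notMem_of_mem_left h hk
      rw [Finset.sum_eq_single_of_mem k (Finset.mem_univ k), Finset.sum_eq_single_of_mem k
        (Finset.mem_univ k)]
      · simp [hk]
      · exact fun l _ hl => indicator_of_notMem (hne l hl) _
      · exact fun l _ hl => indicator_of_notMem (hne l hl) _
    · push Not at hz
      simp [hz]
  simp_rw [h1, h2]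
  rw [lintegral_prod_eq_prod_lintegral_of_indepFun Finset.univ
    (fun k ω => expNeg (c k * numPoints x (B k) ω))
    ((hppp.indep_count n B hB hd).comp (fun k y => expNeg (c k * y)) fun k => by fun_prop)
    fun k => measurable_expNeg.comp ((measurable_numPoints hx (hB k)).const_mul _)]
  rw [lintegral_finsetSum _ fun k _ => measurable_const.indicator (hB k), Finset.mul_sum,
    expNeg_sum]
  refine Finset.prod_congr rfl fun k _ => ?_
  rw [lintegral_expNeg_mul_numPoints hx hppp (hB k) (hB' k), lintegral_indicator_const (hB k),
    mul_comm (volume _)]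

/-- The Laplace functional of a homogeneous Poisson point process. -/
theorem lintegral_expNeg_tsum [IsFiniteMeasure μ] (hx : ∀ j, Measurable (x j))
    (hppp : IsHomogeneousPPP μ lam x) {g : Plane → ℝ≥0∞} (hg : Measurable g) :
    ∫⁻ ω, expNeg (∑' j, g (x j ω)) ∂μ =
      expNeg (ENNReal.ofReal lam * ∫⁻ z, (1 - expNeg (g z))) := by
  -- Cutting off to balls gives the level sets finite area, as the step-function case requires; the
  -- sequence still increases to `g`.
  let gn (n : ℕ) : Plane → ℝ≥0∞ :=
    (Metric.ball (0 : Plane) n).indicator (SimpleFunc.eapprox g n)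
  have hgn_meas (n : ℕ) : Measurable (gn n) :=
    (SimpleFunc.measurable _).indicator measurableSet_ball
  have hgn_mono (z : Plane) : Monotone fun n => gn n z := fun m n hmn =>
    (indicator_le_indicator (SimpleFunc.monotone_eapprox g hmn z)).trans
      (indicator_le_indicator_of_subset (Metric.ball_subset_ball (by exact_mod_cast hmn))
        (fun _ => zero_le) z)
  have hgn_tendsto (z : Plane) : Tendsto (fun n => gn n z) atTop (𝓝 (g z)) := by
    refine (SimpleFunc.tendsto_eapprox hg z).congr' ?_
    obtain ⟨N, hN⟩ := exists_nat_gt ‖z‖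
    filter_upwards [eventually_ge_atTop N] with n hn
    have : z ∈ Metric.ball (0 : Plane) n := by
      rw [mem_ball_zero_iff]
      exact hN.trans_le (by exact_mod_cast hn)
    simp only [gn, indicator_of_mem this]
  have key (n : ℕ) : ∫⁻ ω, expNeg (∑' j, gn n (x j ω)) ∂μ =
      expNeg (ENNReal.ofReal lam * ∫⁻ z, (1 - expNeg (gn n z))) := by
    let f := SimpleFunc.eapprox g n
    let e := f.range.equivFin
    have hgn (z : Plane) : gn n z = ∑ k, (f ⁻¹' {((e.symm k : f.range) : ℝ≥0∞)} ∩
        Metric.ball (0 : Plane) n).indicator (fun _ => ((e.symm k : f.range) : ℝ≥0∞)) z := by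
      by_cases hz : z ∈ Metric.ball (0 : Plane) n
      · rw [Finset.sum_eq_single_of_mem (e ⟨f z, SimpleFunc.mem_range_self f z⟩)
          (Finset.mem_univ _)]
        · simp only [gn, indicator_of_mem hz, Equiv.symm_apply_apply]
          rw [indicator_of_mem]
          exact ⟨rfl, hz⟩
        · refine fun l _ hl => indicator_of_notMem (fun h => hl ?_) _
          rw [← e.symm_apply_eq]
          exact Subtype.ext h.1.symm
      · rw [Finset.sum_eq_zero fun l _ => indicator_of_notMem (fun h => hz h.2) _]
        exact indicator_of_notMem hz _
    simp_rw [hgn]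
    refine lintegral_expNeg_tsum_sum_indicator hx hppp _ _
      (fun k => (f.measurableSet_preimage _).inter measurableSet_ball)
      (fun k => (measure_mono inter_subset_right).trans_lt measure_ball_lt_top) fun k l hkl => ?_
    refine Set.disjoint_left.2 fun z hk hl => hkl (e.symm.injective (Subtype.ext ?_))
    exact hk.1.symm.trans hl.1
  have hl : Tendsto (fun n => ∫⁻ ω, expNeg (∑' j, gn n (x j ω)) ∂μ) atTop
      (𝓝 (∫⁻ ω, expNeg (∑' j, g (x j ω)) ∂μ)) := by
    refine tendsto_lintegral_of_dominated_convergence (fun _ => 1)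
      (fun n => measurable_expNeg.comp (Measurable.tsum fun j =>
        (hgn_meas n).comp (hx j))) (fun n => ae_of_all _ fun ω => expNeg_le_one _) (by simp)
      (ae_of_all _ fun ω => (continuous_expNeg.tendsto _).comp ?_)
    -- Sums over points become integrals against counting measure, to which monotone convergence
    -- applies.
    simp_rw [← lintegral_count]
    exact lintegral_tendsto_of_tendsto_of_monotone (fun n => .of_discrete)
      (ae_of_all _ fun j => hgn_mono _) (ae_of_all _ fun j => hgn_tendsto _)
  have hr : Tendsto (fun n => expNeg (ENNReal.ofReal lam * ∫⁻ z, (1 - expNeg (gn n z)))) atTop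
      (𝓝 (expNeg (ENNReal.ofReal lam * ∫⁻ z, (1 - expNeg (g z))))) := by
    refine (continuous_expNeg.tendsto _).comp (ENNReal.Tendsto.const_mul ?_
      (.inr ENNReal.ofReal_ne_top))
    refine lintegral_tendsto_of_tendsto_of_monotone (fun n => by fun_prop)
      (ae_of_all _ fun z m n hmn => tsub_le_tsub_left (antitone_expNeg (hgn_mono z hmn)) _)
      (ae_of_all _ fun z => ENNReal.Tendsto.sub tendsto_const_nhds
        ((continuous_expNeg.tendsto _).comp (hgn_tendsto z)) (.inl ENNReal.one_ne_top))
  simp_rw [key] at hl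
  exact tendsto_nhds_unique hl hr

end PointProcess

/-! ### Exponential gains -/

section Fading

variable {Ω : Type*} [MeasurableSpace Ω] {μ : Measure Ω}

/-- Fubini with `X` frozen. The inner variable runs over a second copy of `Ω`, so the inner integral
is again a statement about the model. -/
lemma lintegral_comp_prodMk_of_indepFun [IsProbabilityMeasure μ] {β γ : Type*} [MeasurableSpace β]
    [MeasurableSpace γ] {X : Ω → β} {Y : Ω → γ} (hX : Measurable X) (hY : Measurable Y)
    (hXY : IndepFun X Y μ) {φ : β × γ → ℝ≥0∞} (hφ : Measurable φ) :
    ∫⁻ ω, φ (X ω, Y ω) ∂μ = ∫⁻ ω, ∫⁻ ω', φ (X ω, Y ω') ∂μ ∂μ := by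
  have := Measure.isProbabilityMeasure_map hX.aemeasurable (μ := μ)
  have := Measure.isProbabilityMeasure_map hY.aemeasurable (μ := μ)
  rw [← lintegral_map hφ (hX.prodMk hY),
    (indepFun_iff_map_prod_eq_prod_map_map hX.aemeasurable hY.aemeasurable).1 hXY,
    lintegral_prod _ hφ.aemeasurable, lintegral_map hφ.lintegral_prod_right' hX]
  refine lintegral_congr fun ω => ?_
  exact lintegral_map (f := fun y => φ (X ω, y)) (hφ.comp measurable_prodMk_left) hY

lemma lintegral_expMeasure_one {f : ℝ → ℝ≥0∞} (hf : Measurable f) :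
    ∫⁻ y, f y ∂expMeasure 1 = ∫⁻ y in Ioi (0 : ℝ), ENNReal.ofReal (Real.exp (-y)) * f y := by
  have h : expMeasure 1 = volume.withDensity (exponentialPDF 1) := rfl
  rw [h, lintegral_withDensity_eq_lintegral_mul _ (by unfold exponentialPDF; fun_prop) hf,
    setLIntegral_congr Ioi_ae_eq_Ici, ← lintegral_indicator measurableSet_Ici]
  refine lintegral_congr fun y => ?_
  by_cases hy : 0 ≤ y <;> simp [exponentialPDF_eq, hy]

/-- The value `1 / (1 + b)` is written as `exp(-log (1 + b))` so that products over base stations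
become sums inside the Laplace functional. -/
lemma lintegral_expNeg_gain {h : Ω → ℝ} (hh : Measurable h) (hlaw : μ.map h = expMeasure 1)
    {b : ℝ} (hb : 0 ≤ b) :
    ∫⁻ ω, expNeg (ENNReal.ofReal (b * h ω)) ∂μ = expNeg (ENNReal.ofReal (Real.log (1 + b))) := by
  have hm : Measurable fun y : ℝ => expNeg (ENNReal.ofReal (b * y)) := by fun_prop
  rw [← lintegral_map hm hh, hlaw, lintegral_expMeasure_one hm, expNeg_ofReal_log (by linarith)]
  have h1 : ∀ y ∈ Ioi (0 : ℝ), ENNReal.ofReal (Real.exp (-y)) * expNeg (ENNReal.ofReal (b * y)) =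
      ENNReal.ofReal (Real.exp (-(1 + b) * y)) := fun y hy => by
    rw [expNeg_ofReal (mul_nonneg hb (le_of_lt hy)), ← ENNReal.ofReal_mul (Real.exp_nonneg _),
      ← Real.exp_add]
    ring_nf
  rw [setLIntegral_congr_fun measurableSet_Ioi h1, ← ofReal_integral_eq_lintegral_ofReal,
    integral_exp_mul_Ioi (by linarith)]
  · congr 1
    rw [mul_zero, Real.exp_zero, neg_div_neg_eq, one_div]
  · exact integrableOn_exp_mul_Ioi (by linarith) 0
  · exact ae_of_all _ fun _ => Real.exp_nonneg _

/-- For constant `y` this is the exponential tail `P(h > y) = exp(-y)`, with both sides `0` at `y =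
∞`; independence allows averaging over `Y`. -/
lemma measure_lt_gain [IsProbabilityMeasure μ] {h : Ω → ℝ} (hh : Measurable h)
    (hlaw : μ.map h = expMeasure 1) {Y : Ω → ℝ≥0∞} (hY : Measurable Y) (hind : IndepFun Y h μ) :
    μ {ω | Y ω < ENNReal.ofReal (h ω)} = ∫⁻ ω, expNeg (Y ω) ∂μ := by
  have hS : MeasurableSet {p : ℝ≥0∞ × ℝ | p.1 < ENNReal.ofReal p.2} :=
    measurableSet_lt measurable_fst (ENNReal.measurable_ofReal.comp measurable_snd)
  have h1 := lintegral_comp_prodMk_of_indepFun hY hh hind (φ := indicator _ 1)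
    (measurable_one.indicator hS)
  have h2 : MeasurableSet {ω | Y ω < ENNReal.ofReal (h ω)} := (hY.prodMk hh) hS
  rw [← lintegral_indicator_one h2]
  refine h1.trans (lintegral_congr fun ω => ?_)
  have hm (y : ℝ≥0∞) : MeasurableSet {v : ℝ | y < ENNReal.ofReal v} :=
    measurableSet_lt measurable_const ENNReal.measurable_ofReal
  generalize Y ω = y
  have h3 : ∫⁻ ω', ({p : ℝ≥0∞ × ℝ | p.1 < ENNReal.ofReal p.2}.indicator 1 (y, h ω') : ℝ≥0∞) ∂μ =
      ∫⁻ v, {v : ℝ | y < ENNReal.ofReal v}.indicator 1 v ∂expMeasure 1 := by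
    rw [← hlaw, lintegral_map (measurable_one.indicator (hm y)) hh]; rfl
  rw [h3, lintegral_expMeasure_one (measurable_one.indicator (hm y))]
  induction y with
  | top => simp
  | coe y =>
    have h4 (v : ℝ) : ENNReal.ofReal (Real.exp (-v)) *
        ({v : ℝ | (y : ℝ≥0∞) < ENNReal.ofReal v}.indicator 1 v : ℝ≥0∞) =
        (Ioi (y : ℝ)).indicator (fun v => ENNReal.ofReal (Real.exp (-v))) v := by
      by_cases hv : (y : ℝ) < v <;> simp [hv]
    simp_rw [h4]
    rw [setLIntegral_indicator measurableSet_Ioi, inter_eq_left.2 (Ioi_subset_Ioi y.coe_nonneg),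
      ← ofReal_integral_eq_lintegral_ofReal, integral_exp_neg_Ioi, ← expNeg_ofReal y.coe_nonneg,
      ENNReal.ofReal_coe_nnreal]
    · exact (integrableOn_exp_mul_Ioi (a := -1) (by norm_num) (y : ℝ)).congr_fun (fun v _ => by simp)
        measurableSet_Ioi
    · exact ae_of_all _ fun _ => Real.exp_nonneg _

variable {K : Type*} [Countable K] {h : K → Ω → ℝ}

lemma lintegral_expNeg_tsum_gain (hh : ∀ k, Measurable (h k)) (hind : iIndepFun h μ)
    (hlaw : ∀ k, μ.map (h k) = expMeasure 1) {b : K → ℝ} (hb : ∀ k, 0 ≤ b k) :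
    ∫⁻ ω, expNeg (∑' k, ENNReal.ofReal (b k * h k ω)) ∂μ =
      expNeg (∑' k, ENNReal.ofReal (Real.log (1 + b k))) := by
  have := hind.isProbabilityMeasure
  have h1 : Tendsto (fun s : Finset K => ∫⁻ ω, expNeg (∑ k ∈ s, ENNReal.ofReal (b k * h k ω)) ∂μ)
      atTop (𝓝 (∫⁻ ω, expNeg (∑' k, ENNReal.ofReal (b k * h k ω)) ∂μ)) := by
    refine tendsto_lintegral_filter_of_dominated_convergence (fun _ => 1)
      (Eventually.of_forall fun s => measurable_expNeg.comp (by fun_prop))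
      (Eventually.of_forall fun s => ae_of_all _ fun ω => expNeg_le_one _) (by simp)
      (ae_of_all _ fun ω => (continuous_expNeg.tendsto _).comp ENNReal.summable.hasSum)
  have h2 : Tendsto (fun s : Finset K => expNeg (∑ k ∈ s, ENNReal.ofReal (Real.log (1 + b k))))
      atTop (𝓝 (expNeg (∑' k, ENNReal.ofReal (Real.log (1 + b k))))) :=
    (continuous_expNeg.tendsto _).comp ENNReal.summable.hasSum
  refine tendsto_nhds_unique h1 (h2.congr fun s => ?_)
  simp_rw [expNeg_sum]
  rw [lintegral_prod_eq_prod_lintegral_of_indepFun s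
    (fun k ω => expNeg (ENNReal.ofReal (b k * h k ω)))
    (hind.comp (fun k y => expNeg (ENNReal.ofReal (b k * y))) fun k => by fun_prop)
    fun k => by fun_prop]
  exact Finset.prod_congr rfl fun k _ => (lintegral_expNeg_gain (hh k) (hlaw k) (hb k)).symm

/-- Only gains with a nonzero coefficient need be measurable, so the σ-algebra on `Ω` may be the one
generated by these gains, as in `indepFun_tsum_gain`. -/
lemma measurable_tsum_gain {b : K → ℝ} (hh : ∀ k, b k ≠ 0 → Measurable (h k)) :
    Measurable fun ω => ∑' k, ENNReal.ofReal (b k * h k ω) := by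
  refine Measurable.tsum fun k => ?_
  by_cases hk : b k = 0
  · simp [hk]
  · exact ENNReal.measurable_ofReal.comp ((hh k hk).const_mul _)

/-- The series is measurable for the σ-algebra generated by the gains other than `h k₀`, which is
independent of `h k₀`. -/
lemma indepFun_tsum_gain (hh : ∀ k, Measurable (h k)) (hind : iIndepFun h μ) {b : K → ℝ} {k₀ : K}
    (hk₀ : b k₀ = 0) : IndepFun (fun ω => ∑' k, ENNReal.ofReal (b k * h k ω)) (h k₀) μ := by
  have h1 := indep_iSup_of_disjoint (fun k => (hh k).comap_le) hind
    (disjoint_compl_left (a := ({k₀} : Set K)))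
  have h2 := @measurable_tsum_gain Ω
    (⨆ k ∈ ({k₀}ᶜ : Set K), MeasurableSpace.comap (h k) inferInstance) K _ h b fun k hk =>
    Measurable.of_comap_le (le_iSup₂_of_le k (fun h0 => hk (h0 ▸ hk₀)) le_rfl)
  rw [IndepFun_iff_Indep]
  refine indep_of_indep_of_le_left (indep_of_indep_of_le_right h1 ?_) h2.comap_le
  exact le_iSup₂_of_le k₀ rfl le_rfl

end Fading

/-- Polar coordinates: the unit circle has mass `2 * π` and the radial measure is `r dr`. -/
lemma lintegral_plane_norm {f : ℝ → ℝ≥0∞} (hf : Measurable f) :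
    ∫⁻ z : Plane, f ‖z‖ = ∫⁻ r in Ioi (0 : ℝ), ENNReal.ofReal (2 * Real.pi * r) * f r := by
  have h1 : ∫⁻ z : Plane, f ‖z‖ = ∫⁻ z : ({(0 : Plane)}ᶜ : Set Plane), f ‖z.1‖
      ∂(volume.comap Subtype.val) := by
    rw [lintegral_subtype_comap (measurableSet_singleton _).compl fun z : Plane => f ‖z‖,
      restrict_compl_singleton]
  have h2 : ∫⁻ z : ({(0 : Plane)}ᶜ : Set Plane), f ‖z.1‖ ∂(volume.comap Subtype.val) =
      ∫⁻ p, f p.2 ∂(volume : Measure Plane).toSphere.prod (.volumeIoiPow 1) := by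
    have h := (volume : Measure Plane).measurePreserving_homeomorphUnitSphereProd.lintegral_comp_emb
      (Homeomorph.measurableEmbedding _) (f ∘ Subtype.val ∘ Prod.snd)
    simpa using h
  have h3 : (volume : Measure Plane).toSphere univ = ENNReal.ofReal (2 * Real.pi) := by
    rw [Measure.toSphere_apply_univ, EuclideanSpace.volume_ball_fin_two]
    simp [ENNReal.ofReal_mul]
  have hf' : Measurable fun p : Metric.sphere (0 : Plane) 1 × Ioi (0 : ℝ) => f p.2 :=
    hf.comp (measurable_subtype_coe.comp measurable_snd)
  rw [h1, h2, lintegral_prod _ hf'.aemeasurable]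
  dsimp only
  rw [lintegral_const, h3, mul_comm,
    Measure.volumeIoiPow, lintegral_withDensity_eq_lintegral_mul _ (by fun_prop)
      (g := fun r : Ioi (0 : ℝ) => f r) (hf.comp measurable_subtype_coe)]
  simp only [Pi.mul_apply, pow_one]
  rw [lintegral_subtype_comap measurableSet_Ioi fun r : ℝ => ENNReal.ofReal r * f r,
    ← lintegral_const_mul _ (by fun_prop)]
  refine lintegral_congr fun r => ?_
  rw [ENNReal.ofReal_mul (q := r) (by positivity), mul_assoc]

/-! ### The tail integral and the Laplace exponent -/

section TailIntegral

variable {α : ℝ}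

/-- The integrand is bounded near `0` and at most `u ^ (1 - α)` beyond `1`, where `α > 2` gives
convergence. -/
lemma integrableOn_tailIntegrand (hα : 2 < α) :
    IntegrableOn (fun u : ℝ => u / (1 + u ^ α)) (Ioi 0) := by
  have hc : ContinuousOn (fun u : ℝ => u / (1 + u ^ α)) (Ici 0) := by
    refine continuousOn_id.div (continuousOn_const.add
      (Real.continuous_rpow_const (by linarith)).continuousOn) fun u hu => ?_
    have := Real.rpow_nonneg (mem_Ici.1 hu) α
    positivity
  rw [← Ioc_union_Ioi_eq_Ioi zero_le_one, integrableOn_union]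
  constructor
  · exact ((hc.mono Icc_subset_Ici_self).integrableOn_Icc).mono_set Ioc_subset_Icc_self
  · refine (integrableOn_Ioi_rpow_of_lt (a := 1 - α) (by linarith) zero_lt_one).mono'
      ((hc.mono (Ioi_subset_Ici zero_le_one)).aestronglyMeasurable measurableSet_Ioi) ?_
    filter_upwards [ae_restrict_mem measurableSet_Ioi] with u hu
    have hu0 : (0 : ℝ) < u := zero_lt_one.trans hu
    have hp := Real.rpow_pos_of_pos hu0 α
    rw [Real.norm_of_nonneg (by positivity), Real.rpow_sub hu0, Real.rpow_one]
    gcongr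
    linarith

/-- Replacing `u` by `max u 0` extends the integrand continuously to the whole line, so the
fundamental theorem of calculus applies without side conditions. -/
lemma continuous_tailIntegrand_max (hα : 2 < α) :
    Continuous fun u : ℝ => max u 0 / (1 + max u 0 ^ α) := by
  have hm : Continuous fun u : ℝ => max u 0 := by fun_prop
  refine hm.div (continuous_const.add
    ((Real.continuous_rpow_const (by linarith)).comp hm)) fun u => ?_
  have := Real.rpow_nonneg (le_max_right u 0) α
  positivity

lemma tailIntegral_eq_sub (hα : 2 < α) {y : ℝ} (hy : 0 ≤ y) :
    tailIntegral y α =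
      tailIntegral 0 α - ∫ u in (0 : ℝ)..y, max u 0 / (1 + max u 0 ^ α) := by
  have h := intervalIntegral.integral_interval_add_Ioi (integrableOn_tailIntegrand hα)
    ((integrableOn_tailIntegrand hα).mono_set (Ioi_subset_Ioi hy))
  have h2 : ∫ u in (0 : ℝ)..y, max u 0 / (1 + max u 0 ^ α) =
      ∫ u in (0 : ℝ)..y, u / (1 + u ^ α) := by
    refine intervalIntegral.integral_congr fun u hu => ?_
    rw [uIcc_of_le hy] at hu
    simp only [max_eq_left hu.1]
  rw [h2, tailIntegral, tailIntegral, ← h]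
  ring

lemma continuousOn_tailIntegral (hα : 2 < α) :
    ContinuousOn (fun y => tailIntegral y α) (Ici 0) := by
  refine ContinuousOn.congr (Continuous.continuousOn ?_) fun y hy => tailIntegral_eq_sub hα hy
  exact continuous_const.sub (intervalIntegral.continuous_primitive
    (fun a b => (continuous_tailIntegrand_max hα).intervalIntegrable a b) 0)

lemma hasDerivAt_tailIntegral (hα : 2 < α) {y : ℝ} (hy : 0 < y) :
    HasDerivAt (fun y => tailIntegral y α) (-(y / (1 + y ^ α))) y := by
  have h := ((continuous_tailIntegrand_max hα).integral_hasStrictDerivAt 0 y).hasDerivAt.const_sub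
    (tailIntegral 0 α)
  rw [max_eq_left hy.le] at h
  refine h.congr_of_eventuallyEq ?_
  filter_upwards [lt_mem_nhds hy] with v hv using tailIntegral_eq_sub hα hv.le

lemma tailIntegral_nonneg {y : ℝ} (hy : 0 ≤ y) : 0 ≤ tailIntegral y α :=
  setIntegral_nonneg measurableSet_Ioi fun u hu => by
    have : 0 < u := hy.trans_lt hu
    positivity

/-- Substitute `u = c ^ (-1 / α) * r`: then `1 - (1 + c * r ^ (-α))⁻¹ = 1 / (1 + u ^ α)`, and `r dr`
produces the factor `c ^ (2 / α)`. For `c = 0` both sides vanish. -/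
lemma lintegral_Ioi_interference (hα : 2 < α) {c d : ℝ} (hc : 0 ≤ c) (hd : 0 ≤ d) :
    ∫⁻ r in Ioi d, ENNReal.ofReal (2 * Real.pi * r) *
        (1 - expNeg (ENNReal.ofReal (Real.log (1 + c * r ^ (-α))))) =
      ENNReal.ofReal (2 * Real.pi * c ^ (2 / α) * tailIntegral (c ^ (-1 / α) * d) α) := by
  rcases hc.eq_or_lt with rfl | hc
  · have : (2 / α) ≠ 0 := by positivity
    simp [Real.zero_rpow this]
  have hb : 0 < c ^ (-1 / α) := Real.rpow_pos_of_pos hc _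
  have hbα : (c ^ (-1 / α)) ^ α = c⁻¹ := by
    rw [← Real.rpow_mul hc.le, div_mul_cancel₀ _ (by positivity), Real.rpow_neg_one]
  have hb2 : (c ^ (-1 / α))⁻¹ * (c ^ (-1 / α))⁻¹ = c ^ (2 / α) := by
    rw [← Real.rpow_neg hc.le, ← Real.rpow_add hc]
    congr 1
    ring
  have h1 : ∀ r ∈ Ioi d, ENNReal.ofReal (2 * Real.pi * r) *
      (1 - expNeg (ENNReal.ofReal (Real.log (1 + c * r ^ (-α))))) =
      ENNReal.ofReal (2 * Real.pi * (c ^ (-1 / α))⁻¹ *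
        (c ^ (-1 / α) * r / (1 + (c ^ (-1 / α) * r) ^ α))) := fun r hr => by
    have hr0 : 0 < r := hd.trans_lt hr
    have hp : 0 < r ^ α := Real.rpow_pos_of_pos hr0 α
    rw [expNeg_ofReal_log (by rw [Real.rpow_neg hr0.le]; simp; positivity), ← ENNReal.ofReal_one,
      ← ENNReal.ofReal_sub _ (by positivity), ← ENNReal.ofReal_mul (by positivity)]
    congr 1
    rw [Real.mul_rpow hb.le hr0.le, hbα, Real.rpow_neg hr0.le]
    field_simp
    ring
  have hi : IntegrableOn (fun u : ℝ => u / (1 + u ^ α)) (Ioi (c ^ (-1 / α) * d)) :=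
    (integrableOn_tailIntegrand hα).mono_set (Ioi_subset_Ioi (by positivity))
  rw [setLIntegral_congr_fun measurableSet_Ioi h1, ← ofReal_integral_eq_lintegral_ofReal,
    integral_const_mul, integral_comp_mul_left_Ioi (fun u => u / (1 + u ^ α)) d hb, smul_eq_mul,
    ← hb2, tailIntegral]
  · ring_nf
  · exact ((integrableOn_Ioi_comp_mul_left_iff _ d hb).2 hi).const_mul _
  · filter_upwards [ae_restrict_mem measurableSet_Ioi] with r hr
    have hr0 : 0 < r := hd.trans_lt hr
    positivity

/-- The mean `lam * area` of the number of points of a homogeneous Poisson process in the disc of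
radius `d`, plus the exponent of the Laplace transform of the interference from outside it. -/
noncomputable def laplaceExponent (α lam c d : ℝ) : ℝ :=
  lam * (Real.pi * d ^ 2 + 2 * Real.pi * c ^ (2 / α) * tailIntegral (c ^ (-1 / α) * d) α)

/-- Inside the disc the integrand is `1 - exp(-∞) = 1`, which gives the area `π * d ^ 2`; outside it
is the integrand of `lintegral_Ioi_interference`. -/
lemma lintegral_one_sub_expNeg_exclusion (hα : 2 < α) {lam c d : ℝ} (hlam : 0 ≤ lam) (hc : 0 ≤ c)
    (hd : 0 ≤ d) :
    ENNReal.ofReal lam * ∫⁻ z : Plane, (1 - expNeg (if d < ‖z‖ then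
      ENNReal.ofReal (Real.log (1 + c * ‖z‖ ^ (-α))) else ∞)) =
      ENNReal.ofReal (laplaceExponent α lam c d) := by
  have hm : Measurable fun r : ℝ => 1 - expNeg (if d < r then
      ENNReal.ofReal (Real.log (1 + c * r ^ (-α))) else ∞) := by
    refine measurable_const.sub (measurable_expNeg.comp
      (Measurable.ite measurableSet_Ioi ?_ measurable_const))
    fun_prop
  rw [lintegral_plane_norm hm, ← Ioc_union_Ioi_eq_Ioi hd,
    lintegral_union measurableSet_Ioi Ioc_disjoint_Ioi_same,
    setLIntegral_congr_fun (g := fun r => ENNReal.ofReal (2 * Real.pi * r) *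
        (1 - expNeg (ENNReal.ofReal (Real.log (1 + c * r ^ (-α)))))) measurableSet_Ioi
      fun r (hr : d < r) => by simp only [if_pos hr],
    lintegral_Ioi_interference hα hc hd,
    setLIntegral_congr_fun (g := fun r => ENNReal.ofReal (2 * Real.pi * r)) measurableSet_Ioc
      fun r (hr : r ∈ Ioc 0 d) => by simp [hr.2.not_gt],
    ← ofReal_integral_eq_lintegral_ofReal, ← intervalIntegral.integral_of_le hd,
    intervalIntegral.integral_const_mul, integral_id, laplaceExponent, ENNReal.ofReal_mul hlam,
    ENNReal.ofReal_add (by positivity)]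
  · have : 2 * Real.pi * ((d ^ 2 - 0 ^ 2) / 2) = Real.pi * d ^ 2 := by ring
    rw [this]
  · have := tailIntegral_nonneg (α := α) (y := c ^ (-1 / α) * d) (by positivity)
    positivity
  · exact (Continuous.integrableOn_Icc (by fun_prop)).mono_set Ioc_subset_Icc_self
  · filter_upwards [ae_restrict_mem measurableSet_Ioc] with r hr
    have := hr.1
    positivity

lemma laplaceExponent_ge {lam c d : ℝ} (hlam : 0 ≤ lam) (hc : 0 ≤ c) (hd : 0 ≤ d) :
    lam * (Real.pi * d ^ 2) ≤ laplaceExponent α lam c d := by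
  have := tailIntegral_nonneg (α := α) (y := c ^ (-1 / α) * d) (by positivity)
  rw [laplaceExponent]
  gcongr
  rw [le_add_iff_nonneg_right]
  positivity

/-- As `d` grows, the area gains `2πd` while the outer integral loses `2πd (1 - (1 + c * d ^
(-α))⁻¹)`. -/
lemma hasDerivAt_laplaceExponent (hα : 2 < α) {lam c d : ℝ} (hc : 0 ≤ c) (hd : 0 < d) :
    HasDerivAt (laplaceExponent α lam c) (2 * Real.pi * lam * d * (1 + c * d ^ (-α))⁻¹) d := by
  rcases hc.eq_or_lt with rfl | hc
  · have h2 : (2 / α) ≠ 0 := by positivity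
    have : laplaceExponent α lam 0 = fun d => lam * (Real.pi * d ^ 2) := by
      ext d
      simp [laplaceExponent, Real.zero_rpow h2]
    rw [this]
    refine (((hasDerivAt_pow 2 d).const_mul Real.pi).const_mul lam).congr_deriv ?_
    simp
    ring
  have hb : 0 < c ^ (-1 / α) := Real.rpow_pos_of_pos hc _
  have hbα : (c ^ (-1 / α)) ^ α = c⁻¹ := by
    rw [← Real.rpow_mul hc.le, div_mul_cancel₀ _ (by positivity), Real.rpow_neg_one]
  have hb2 : c ^ (2 / α) = (c ^ (-1 / α))⁻¹ * (c ^ (-1 / α))⁻¹ := by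
    rw [← Real.rpow_neg hc.le, ← Real.rpow_add hc]
    congr 1
    ring
  have hT : HasDerivAt (fun d => tailIntegral (c ^ (-1 / α) * d) α) _ d :=
    (hasDerivAt_tailIntegral hα (mul_pos hb hd)).comp d ((hasDerivAt_id d).const_mul _)
  refine ((((hasDerivAt_pow 2 d).const_mul Real.pi).add
    (hT.const_mul (2 * Real.pi * c ^ (2 / α)))).const_mul lam).congr_deriv ?_
  have hp : 0 < d ^ α := Real.rpow_pos_of_pos hd α
  rw [Real.mul_rpow hb.le hd.le, hbα, hb2, Real.rpow_neg hd.le]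
  generalize c ^ (-1 / α) = b at *
  field_simp
  push_cast
  ring

lemma continuousOn_laplaceExponent (hα : 2 < α) {lam c : ℝ} (hc : 0 ≤ c) :
    ContinuousOn (laplaceExponent α lam c) (Ici 0) := by
  unfold laplaceExponent
  have h : ContinuousOn (fun d => tailIntegral (c ^ (-1 / α) * d) α) (Ici 0) :=
    (continuousOn_tailIntegral hα).comp (f := fun d => c ^ (-1 / α) * d) (by fun_prop)
      fun d (hd : 0 ≤ d) => mul_nonneg (Real.rpow_nonneg hc _) hd
  fun_prop

/-- The integrand is the derivative of `-exp(-Λ(r))`, which tends to `0` because `Λ(r) ≥ λ π r ^ 2`.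
-/
lemma lintegral_Ioi_nearest_density (hα : 2 < α) {lam c a : ℝ} (hlam : 0 < lam) (hc : 0 ≤ c)
    (ha : 0 ≤ a) :
    ∫⁻ r in Ioi a, ENNReal.ofReal (2 * Real.pi * lam * r * (1 + c * r ^ (-α))⁻¹ *
      Real.exp (-laplaceExponent α lam c r)) =
      ENNReal.ofReal (Real.exp (-laplaceExponent α lam c a)) := by
  have hcont : ContinuousWithinAt (fun r => -Real.exp (-laplaceExponent α lam c r)) (Ici a) a :=
    ((((continuousOn_laplaceExponent hα hc).mono (Ici_subset_Ici.2 ha)).neg.rexp).neg) a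
      self_mem_Ici
  have hderiv : ∀ r ∈ Ioi a, HasDerivAt (fun r => -Real.exp (-laplaceExponent α lam c r))
      (2 * Real.pi * lam * r * (1 + c * r ^ (-α))⁻¹ * Real.exp (-laplaceExponent α lam c r)) r :=
    fun r hr => (hasDerivAt_laplaceExponent hα hc (ha.trans_lt hr)).fun_neg.exp.fun_neg.congr_deriv
      (by ring)
  have hpos : ∀ r ∈ Ioi a, 0 ≤ 2 * Real.pi * lam * r * (1 + c * r ^ (-α))⁻¹ *
      Real.exp (-laplaceExponent α lam c r) := fun r hr => by
    have : 0 < r := ha.trans_lt hr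
    positivity
  have hlim : Tendsto (fun r => -Real.exp (-laplaceExponent α lam c r)) atTop (𝓝 0) := by
    rw [← neg_zero]
    refine (Real.tendsto_exp_atBot.comp (tendsto_neg_atTop_atBot.comp ?_)).neg
    refine tendsto_atTop_mono' atTop (f₁ := fun r => lam * (Real.pi * r ^ 2)) ?_ ?_
    · filter_upwards [eventually_ge_atTop 0] with r hr using laplaceExponent_ge hlam.le hc hr
    · exact ((tendsto_pow_atTop two_ne_zero).const_mul_atTop Real.pi_pos).const_mul_atTop hlam
  rw [← ofReal_integral_eq_lintegral_ofReal
    (integrableOn_Ioi_deriv_of_nonneg hcont hderiv hpos hlim)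
    ((ae_restrict_mem measurableSet_Ioi).mono hpos),
    integral_Ioi_of_hasDerivAt_of_nonneg hcont hderiv hpos hlim]
  simp

end TailIntegral

/-! ### Measurability of the model -/

section Measurability

variable {Ω : Type*} [MeasurableSpace Ω] {x : Tier → ℕ → Ω → Plane} {h : Tier → ℕ → Ω → ℝ}

lemma measurable_comp_index {β : Type*} [MeasurableSpace β] {f : ℕ → Ω → β} {N : Ω → ℕ}
    (hf : ∀ j, Measurable (f j)) (hN : Measurable N) : Measurable fun ω => f (N ω) ω := by
  have h1 : Measurable fun p : ℕ × Ω => f p.1 p.2 := measurable_from_prod_countable_right hf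
  exact h1.comp (hN.prodMk measurable_id)

lemma measurable_nearestIdx (hx : ∀ i j, Measurable (x i j)) (i : Tier) :
    Measurable (nearestIdx x i) := by
  have hS (j : ℕ) : MeasurableSet {ω | ∀ k, ‖x i j ω‖ ≤ ‖x i k ω‖} := by
    rw [ofPred_forall]
    exact MeasurableSet.iInter fun k => measurableSet_le (hx i j).norm (hx i k).norm
  refine measurable_to_countable' fun n => ?_
  -- The second piece covers configurations without a minimiser, where `sInf ∅ = 0`.
  have h1 : nearestIdx x i ⁻¹' {n} =
      ({ω | ∀ k, ‖x i n ω‖ ≤ ‖x i k ω‖} ∩ ⋂ m < n, {ω | ∀ k, ‖x i m ω‖ ≤ ‖x i k ω‖}ᶜ) ∪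
        ({_ω | n = 0} ∩ ⋂ m, {ω | ∀ k, ‖x i m ω‖ ≤ ‖x i k ω‖}ᶜ) := by
    ext ω
    simp only [mem_preimage, mem_singleton_iff, mem_union, mem_inter_iff, mem_iInter,
      mem_compl_iff, mem_ofPred_eq]
    constructor
    · rintro rfl
      rcases eq_empty_or_nonempty {j | ∀ k, ‖x i j ω‖ ≤ ‖x i k ω‖} with he | hne
      · refine .inr ⟨?_, fun m hm => ?_⟩
        · rw [nearestIdx, he, Nat.sInf_empty]
        · exact (he ▸ (show m ∈ {j | ∀ k, ‖x i j ω‖ ≤ ‖x i k ω‖} from hm) : m ∈ (∅ : Set ℕ))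
      · exact .inl ⟨Nat.sInf_mem hne, fun m hm => Nat.notMem_of_lt_sInf hm⟩
    · rintro (⟨hn, hlt⟩ | ⟨rfl, hall⟩)
      · refine le_antisymm (Nat.sInf_le hn) (not_lt.1 fun hlt' => hlt _ hlt' ?_)
        exact Nat.sInf_mem (s := {j | ∀ k, ‖x i j ω‖ ≤ ‖x i k ω‖}) ⟨n, hn⟩
      · rw [nearestIdx, show {j | ∀ k, ‖x i j ω‖ ≤ ‖x i k ω‖} = ∅ from
          eq_empty_of_forall_notMem hall, Nat.sInf_empty]
  rw [h1]
  exact ((hS n).inter (MeasurableSet.iInter fun m => MeasurableSet.iInter fun _ =>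
    (hS m).compl)).union ((MeasurableSet.const _).inter (MeasurableSet.iInter fun m =>
      (hS m).compl))

lemma measurable_nearestDist (hx : ∀ i j, Measurable (x i j)) (i : Tier) :
    Measurable (nearestDist x i) := by
  exact measurable_comp_index (f := fun j ω => ‖x i j ω‖) (fun j => (hx i j).norm)
    (measurable_nearestIdx hx i)

lemma measurableSet_association (hx : ∀ i j, Measurable (x i j)) (α : ℝ) (P : Tier → ℝ)
    (i : Tier) : MeasurableSet (association α P x i) := by
  have hr (k : Tier) : Measurable (rss α P x k) :=
    ((measurable_nearestDist hx k).pow_const _).const_mul _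
  cases i with
  | mbs => exact measurableSet_lt (hr _) (hr _)
  | sbs => exact measurableSet_le (hr _) (hr _)

lemma measurable_receivedPower (hx : ∀ i j, Measurable (x i j)) (hh : ∀ i j, Measurable (h i j))
    (α : ℝ) (P : Tier → ℝ) (i : Tier) (j : ℕ) : Measurable (receivedPower α P x h i j) :=
  ((hh i j).const_mul _).mul ((hx i j).norm.pow_const _)

lemma measurable_interference (hx : ∀ i j, Measurable (x i j)) (hh : ∀ i j, Measurable (h i j))
    (α : ℝ) (P : Tier → ℝ) (i : Tier) : Measurable (interference α P x h i) := by
  refine Measurable.tsum fun k => Measurable.ite ?_ measurable_const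
    (ENNReal.measurable_ofReal.comp (measurable_receivedPower hx hh α P _ _))
  simp only [Prod.ext_iff]
  exact (MeasurableSet.const _).inter
    (measurableSet_eq_fun measurable_const (measurable_nearestIdx hx i))

lemma measurable_sinr (hx : ∀ i j, Measurable (x i j)) (hh : ∀ i j, Measurable (h i j))
    (α σ : ℝ) (P : Tier → ℝ) (i : Tier) : Measurable (sinr α σ P x h i) := by
  exact (ENNReal.measurable_ofReal.comp (measurable_comp_index
    (f := fun j ω => receivedPower α P x h i j ω) (measurable_receivedPower hx hh α P i)
    (measurable_nearestIdx hx i))).div ((measurable_interference hx hh α P i).add_const _)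

end Measurability

/-! ### The nearest point of a locally finite configuration -/

section NearestPoint

variable {Ω : Type*} {x : Tier → ℕ → Ω → Plane} {i : Tier} {ω : Ω}

lemma nearestDist_nonneg : 0 ≤ nearestDist x i ω := norm_nonneg _

/-- The minimum over the finite set of points no farther than the point of index `0` is a global
minimum, so the infimum defining `nearestIdx` is taken over a nonempty set. -/
lemma nearestDist_le (hfin : ∀ R, {j | ‖x i j ω‖ ≤ R}.Finite) (j : ℕ) :
    nearestDist x i ω ≤ ‖x i j ω‖ := by
  obtain ⟨m, hm, hmin⟩ := exists_min_image _ (fun j => ‖x i j ω‖) (hfin ‖x i 0 ω‖)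
    ⟨0, le_refl ‖x i 0 ω‖⟩
  have hne : {j | ∀ k, ‖x i j ω‖ ≤ ‖x i k ω‖}.Nonempty := by
    refine ⟨m, fun k => ?_⟩
    by_cases hk : ‖x i k ω‖ ≤ ‖x i 0 ω‖
    · exact hmin k hk
    · exact (show ‖x i m ω‖ ≤ ‖x i 0 ω‖ from hm).trans (le_of_not_ge hk)
  exact Nat.sInf_mem hne j

lemma lt_nearestDist_iff (hfin : ∀ R, {j | ‖x i j ω‖ ≤ R}.Finite) {d : ℝ} :
    d < nearestDist x i ω ↔ ∀ j, d < ‖x i j ω‖ :=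
  ⟨fun hd j => hd.trans_le (nearestDist_le hfin j), fun hd => hd _⟩

/-- One point in the disc makes the sum infinite, so the value `∞` acts as the indicator that the
disc is empty. -/
lemma expNeg_tsum_exclusion (hfin : ∀ R, {j | ‖x i j ω‖ ≤ R}.Finite) (g : ℝ → ℝ≥0∞) (d : ℝ) :
    expNeg (∑' j, if d < ‖x i j ω‖ then g ‖x i j ω‖ else ∞) =
      if d < nearestDist x i ω then expNeg (∑' j, g ‖x i j ω‖) else 0 := by
  split_ifs with hd
  · simp [(lt_nearestDist_iff hfin).1 hd]
  · have h1 : ∃ j, ¬ d < ‖x i j ω‖ := by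
      simpa using mt (lt_nearestDist_iff hfin).2 hd
    obtain ⟨j, hj⟩ := h1
    rw [ENNReal.tsum_eq_top_of_eq_top ⟨j, if_neg hj⟩, expNeg_top]

lemma expNeg_tsum_eq_mul_nearest (g : ℝ → ℝ≥0∞) :
    expNeg (∑' j, g ‖x i j ω‖) = expNeg (g (nearestDist x i ω)) *
      expNeg (∑' j, if j = nearestIdx x i ω then 0 else g ‖x i j ω‖) := by
  have key (n : ℕ) : expNeg (∑' j, g ‖x i j ω‖) = expNeg (g ‖x i n ω‖) *
      expNeg (∑' j, if j = n then 0 else g ‖x i j ω‖) := by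
    rw [← expNeg_add, ENNReal.tsum_eq_add_tsum_ite n]
    congr!
  exact key _

end NearestPoint

/-! ### Law of the nearest point, weighted by the remaining points -/

section NearestLaw

variable {Ω : Type*} [MeasurableSpace Ω] {μ : Measure Ω} {lam : ℝ} {x : Tier → ℕ → Ω → Plane}
  {i : Tier}

lemma ae_finite_norm_le (hx : ∀ i j, Measurable (x i j)) (hppp : IsHomogeneousPPP μ lam (x i)) :
    ∀ᵐ ω ∂μ, ∀ R, {j | ‖x i j ω‖ ≤ R}.Finite := by
  have h1 (n : ℕ) : ∀ᵐ ω ∂μ, numPoints (x i) (Metric.closedBall 0 n) ω ≠ ∞ := by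
    have hN := measurable_numPoints (hx i) (measurableSet_closedBall (x := 0) (ε := (n : ℝ)))
    refine ae_of_ae_map hN.aemeasurable (p := fun y => y ≠ ∞) ?_
    rw [hppp.poisson_count _ measurableSet_closedBall measure_closedBall_lt_top]
    exact (ae_map_iff (Measurable.of_discrete.aemeasurable) (measurableSet_singleton _).compl).2
      (ae_of_all _ fun n => ENNReal.natCast_ne_top n)
  filter_upwards [ae_all_iff.2 h1] with ω hω R
  obtain ⟨n, hn⟩ := exists_nat_ge R
  refine (ENNReal.finite_const_le_of_tsum_ne_top (hω n) one_ne_zero).subset fun j hj => ?_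
  have : x i j ω ∈ Metric.closedBall (0 : Plane) n := by
    rw [mem_closedBall_zero_iff]
    exact hj.trans hn
  simp [this]

lemma ae_notMem_of_volume_eq_zero (hx : ∀ i j, Measurable (x i j))
    (hppp : IsHomogeneousPPP μ lam (x i)) {B : Set Plane} (hB : MeasurableSet B)
    (hB0 : volume B = 0) : ∀ᵐ ω ∂μ, ∀ j, x i j ω ∉ B := by
  have h0 : ∀ᵐ n ∂poissonMeasure 0, n = 0 := by
    have : poissonMeasure 0 {0} = 1 := by simp [poissonMeasure_singleton]
    exact (prob_compl_eq_zero_iff (measurableSet_singleton 0)).2 this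
  have h1 : ∀ᵐ ω ∂μ, numPoints (x i) B ω = 0 := by
    refine ae_of_ae_map (measurable_numPoints (hx i) hB).aemeasurable (p := fun y => y = 0) ?_
    rw [hppp.poisson_count B hB (by simp [hB0])]
    refine (ae_map_iff (p := fun y => y = 0) (Measurable.of_discrete.aemeasurable)
      (measurableSet_singleton _)).2 ?_
    simpa [measureReal_def, hB0] using h0
  filter_upwards [h1] with ω hω j hj
  have := ENNReal.tsum_eq_zero.1 hω j
  simp [hj] at this

lemma ae_nearestDist_ne (hx : ∀ i j, Measurable (x i j)) (hppp : IsHomogeneousPPP μ lam (x i))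
    (d : ℝ) : ∀ᵐ ω ∂μ, nearestDist x i ω ≠ d := by
  rcases lt_or_ge d 0 with hd | hd
  · exact ae_of_all _ fun ω => (hd.trans_le nearestDist_nonneg).ne'
  · filter_upwards [ae_notMem_of_volume_eq_zero hx hppp (B := Metric.sphere 0 d)
      Metric.isClosed_sphere.measurableSet (Measure.addHaar_sphere _ _ _)] with ω hω hd
    exact hω (nearestIdx x i ω) (mem_sphere_zero_iff_norm.2 hd)

lemma ae_nearestDist_pos (hx : ∀ i j, Measurable (x i j)) (hppp : IsHomogeneousPPP μ lam (x i)) :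
    ∀ᵐ ω ∂μ, 0 < nearestDist x i ω := by
  filter_upwards [ae_nearestDist_ne hx hppp 0] with ω hω
  exact nearestDist_nonneg.lt_of_ne' hω

/-- The exponent contributed by a point at distance `r` to the conditional Laplace transform of
the interference, given the locations. -/
noncomputable def logGain (α c r : ℝ) : ℝ≥0∞ := ENNReal.ofReal (Real.log (1 + c * r ^ (-α)))

@[fun_prop]
lemma measurable_logGain (α c : ℝ) : Measurable (logGain α c) := by
  unfold logGain
  fun_prop

variable {α c : ℝ}

lemma lintegral_expNeg_tsum_exclusion [IsFiniteMeasure μ] (hx : ∀ i j, Measurable (x i j))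
    (hppp : IsHomogeneousPPP μ lam (x i)) (hα : 2 < α) (hlam : 0 ≤ lam) (hc : 0 ≤ c) {d : ℝ}
    (hd : 0 ≤ d) :
    ∫⁻ ω, expNeg (∑' j, if d < ‖x i j ω‖ then logGain α c ‖x i j ω‖ else ∞) ∂μ =
      ENNReal.ofReal (Real.exp (-laplaceExponent α lam c d)) := by
  have hm : Measurable fun z : Plane => if d < ‖z‖ then logGain α c ‖z‖ else ∞ :=
    Measurable.ite (measurableSet_lt measurable_const measurable_norm) (by fun_prop)
      measurable_const
  rw [lintegral_expNeg_tsum (hx i) hppp hm]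
  unfold logGain
  rw [lintegral_one_sub_expNeg_exclusion hα hlam hc hd, expNeg_ofReal]
  exact (by positivity : 0 ≤ lam * (Real.pi * d ^ 2)).trans (laplaceExponent_ge hlam hc hd)

/-- Under the weight of all points, the Laplace functional with an empty disc gives the tail
`exp(-Λ(a))` for `R > a`. The right side has the same mass on these rays, and rays form a generating
π-system. -/
lemma map_nearestDist_withDensity [IsFiniteMeasure μ] (hx : ∀ i j, Measurable (x i j))
    (hppp : IsHomogeneousPPP μ lam (x i)) (hα : 2 < α) (hlam : 0 < lam) (hc : 0 ≤ c) :
    (μ.withDensity fun ω => expNeg (∑' j, logGain α c ‖x i j ω‖)).map (nearestDist x i) =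
      (volume.restrict (Ioi (0 : ℝ))).withDensity fun r => ENNReal.ofReal
        (2 * Real.pi * lam * r * (1 + c * r ^ (-α))⁻¹ *
          Real.exp (-laplaceExponent α lam c r)) := by
  have hR := measurable_nearestDist hx i
  have hbase {a : ℝ} (ha : 0 ≤ a) :
      (μ.withDensity fun ω => expNeg (∑' j, logGain α c ‖x i j ω‖)).map (nearestDist x i) (Ioi a) =
      ENNReal.ofReal (Real.exp (-laplaceExponent α lam c a)) := by
    rw [Measure.map_apply hR measurableSet_Ioi, withDensity_apply _ (hR measurableSet_Ioi),
      ← lintegral_indicator (hR measurableSet_Ioi),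
      ← lintegral_expNeg_tsum_exclusion hx hppp hα hlam.le hc ha]
    refine lintegral_congr_ae ?_
    filter_upwards [ae_finite_norm_le hx hppp] with ω hω
    rw [expNeg_tsum_exclusion hω]
    rfl
  have hbase' {a : ℝ} (ha : 0 ≤ a) :
      ((volume.restrict (Ioi (0 : ℝ))).withDensity fun r => ENNReal.ofReal
        (2 * Real.pi * lam * r * (1 + c * r ^ (-α))⁻¹ *
          Real.exp (-laplaceExponent α lam c r))) (Ioi a) =
      ENNReal.ofReal (Real.exp (-laplaceExponent α lam c a)) := by
    rw [withDensity_apply _ measurableSet_Ioi, Measure.restrict_restrict measurableSet_Ioi,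
      inter_eq_left.2 (Ioi_subset_Ioi ha), lintegral_Ioi_nearest_density hα hlam hc ha]
  -- Neither measure charges `(-∞, 0]`; this handles both the rays starting at `a ≤ 0` and the total
  -- masses.
  have hneg (S : Set ℝ) (hS0 : Ioi 0 ⊆ S) :
      (μ.withDensity fun ω => expNeg (∑' j, logGain α c ‖x i j ω‖)).map (nearestDist x i) S =
      ((volume.restrict (Ioi (0 : ℝ))).withDensity fun r => ENNReal.ofReal
        (2 * Real.pi * lam * r * (1 + c * r ^ (-α))⁻¹ *
          Real.exp (-laplaceExponent α lam c r))) S := by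
    have hcongr (ν : Measure ℝ) (h0 : ν (Iic 0) = 0) : ν S = ν (Ioi 0) := by
      refine le_antisymm ?_ (measure_mono hS0)
      calc ν S ≤ ν (Ioi 0 ∪ Iic 0) := measure_mono ((subset_univ _).trans_eq Ioi_union_Iic.symm)
        _ ≤ ν (Ioi 0) + ν (Iic 0) := measure_union_le _ _
        _ = ν (Ioi 0) := by rw [h0, add_zero]
    rw [hcongr, hcongr, hbase le_rfl, hbase' le_rfl]
    · refine withDensity_absolutelyContinuous _ _ ?_
      rw [Measure.restrict_apply measurableSet_Iic, Iic_inter_Ioi, Ioc_self, measure_empty]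
    · rw [Measure.map_apply hR measurableSet_Iic]
      refine withDensity_absolutelyContinuous _ _ (measure_eq_zero_iff_ae_notMem.2 ?_)
      filter_upwards [ae_nearestDist_pos hx hppp] with ω hω using not_le.2 hω
  have : IsFiniteMeasure ((μ.withDensity fun ω => expNeg (∑' j, logGain α c ‖x i j ω‖)).map
      (nearestDist x i)) := by
    have := isFiniteMeasure_withDensity (μ := μ)
      (f := fun ω => expNeg (∑' j, logGain α c ‖x i j ω‖))
      ((lintegral_mono fun ω => expNeg_le_one _).trans_lt (by simp)).ne
    infer_instance
  refine ext_of_generate_finite _ (BorelSpace.measurable_eq.trans (borel_eq_generateFrom_Ioi ℝ))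
    isPiSystem_Ioi ?_ (hneg _ (subset_univ _))
  rintro _ ⟨a, rfl⟩
  rcases le_total 0 a with ha | ha
  · rw [hbase ha, hbase' ha]
  · exact hneg _ (Ioi_subset_Ioi ha)

/-- Given that the nearest point is at distance `r`, the other points form a Poisson process
outside the disc of radius `r`. -/
lemma lintegral_nearestDist_mul_expNeg [IsFiniteMeasure μ] (hx : ∀ i j, Measurable (x i j))
    (hppp : IsHomogeneousPPP μ lam (x i)) (hα : 2 < α) (hlam : 0 < lam) (hc : 0 ≤ c)
    {φ : ℝ → ℝ≥0∞} (hφ : Measurable φ) :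
    ∫⁻ ω, φ (nearestDist x i ω) *
        expNeg (∑' j, if j = nearestIdx x i ω then 0 else logGain α c ‖x i j ω‖) ∂μ =
      ∫⁻ r in Ioi (0 : ℝ), φ r * ENNReal.ofReal (2 * Real.pi * lam * r *
        Real.exp (-laplaceExponent α lam c r)) := by
  have hR := measurable_nearestDist hx i
  have hE : Measurable fun ω => expNeg (∑' j, logGain α c ‖x i j ω‖) :=
    measurable_expNeg.comp (Measurable.tsum fun j => (measurable_logGain α c).comp (hx i j).norm)
  have hψ : Measurable fun r : ℝ => φ r * ENNReal.ofReal (1 + c * r ^ (-α)) := by fun_prop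
  have hone (r : ℝ) (hr : 0 < r) : 1 ≤ 1 + c * r ^ (-α) := by
    have := Real.rpow_nonneg hr.le (-α)
    have : 0 ≤ c * r ^ (-α) := by positivity
    linarith
  calc
    -- The factor `1 + c * R ^ (-α)` cancels the contribution of the nearest point to the full
    -- weight.
    _ = ∫⁻ ω, expNeg (∑' j, logGain α c ‖x i j ω‖) *
        (φ (nearestDist x i ω) * ENNReal.ofReal (1 + c * nearestDist x i ω ^ (-α))) ∂μ := by
      refine lintegral_congr_ae ?_
      filter_upwards [ae_nearestDist_pos hx hppp] with ω hω
      have h1 := hone _ hω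
      rw [expNeg_tsum_eq_mul_nearest (i := i) (logGain α c)]
      have h2 : expNeg (logGain α c (nearestDist x i ω)) *
          ENNReal.ofReal (1 + c * nearestDist x i ω ^ (-α)) = 1 := by
        rw [logGain, expNeg_ofReal_log h1, ← ENNReal.ofReal_mul (by positivity),
          inv_mul_cancel₀ (by positivity), ENNReal.ofReal_one]
      calc _ = φ (nearestDist x i ω) * expNeg (∑' j, if j = nearestIdx x i ω then 0 else
            logGain α c ‖x i j ω‖) * (expNeg (logGain α c (nearestDist x i ω)) *
              ENNReal.ofReal (1 + c * nearestDist x i ω ^ (-α))) := by rw [h2, mul_one]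
        _ = _ := by ring
    _ = ∫⁻ r, φ r * ENNReal.ofReal (1 + c * r ^ (-α)) ∂(μ.withDensity fun ω =>
        expNeg (∑' j, logGain α c ‖x i j ω‖)).map (nearestDist x i) := by
      rw [lintegral_map hψ hR]
      exact (lintegral_withDensity_eq_lintegral_mul _ hE (hψ.comp hR)).symm
    _ = _ := by
      rw [map_nearestDist_withDensity hx hppp hα hlam hc,
        lintegral_withDensity_eq_lintegral_mul₀ _ hψ.aemeasurable]
      · refine setLIntegral_congr_fun measurableSet_Ioi fun r (hr : 0 < r) => ?_
        have h1 := hone r hr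
        rw [Pi.mul_apply, mul_comm, mul_assoc, ← ENNReal.ofReal_mul (by positivity)]
        congr 2
        field_simp
      · refine ENNReal.measurable_ofReal.comp_aemeasurable (AEMeasurable.mul (by fun_prop) ?_)
        exact (((continuousOn_laplaceExponent hα hc).mono Ioi_subset_Ici_self).neg.rexp).aemeasurable
          measurableSet_Ioi

end NearestLaw

/-! ### Joint law for the two tiers -/

section Locations

variable {Ω : Type*} [MeasurableSpace Ω] {μ : Measure Ω} {x : Tier → ℕ → Ω → Plane}
  {lam P : Tier → ℝ} {α : ℝ}

lemma tsum_tier {i k : Tier} (hik : i ≠ k) (f : Tier × ℕ → ℝ≥0∞) :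
    ∑' p, f p = ∑' j, f (i, j) + ∑' j, f (k, j) := by
  rw [ENNReal.tsum_prod', tsum_fintype, Fintype.sum_eq_add i k hik]
  rintro l ⟨h1, h2⟩
  cases i <;> cases k <;> cases l <;> simp_all

/-- Joint law of the serving distance and of the locations of the interferers, on the event that
the nearest point of tier `k` is more than `a` times as far away as that of tier `i`. -/
lemma lintegral_indicator_lt_mul_expNeg [IsProbabilityMeasure μ]
    (hx : ∀ i j, Measurable (x i j)) {i k : Tier} (hik : i ≠ k)
    (hind : IndepFun (fun ω j => x i j ω) (fun ω j => x k j ω) μ)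
    (hppp : ∀ i, IsHomogeneousPPP μ (lam i) (x i)) (hα : 2 < α) (hlam : ∀ i, 0 < lam i)
    {c : Tier → ℝ} (hc : ∀ i, 0 ≤ c i) {a : ℝ} (ha : 0 ≤ a) {φ : ℝ → ℝ≥0∞} (hφ : Measurable φ) :
    ∫⁻ ω in {ω | a * nearestDist x i ω < nearestDist x k ω}, φ (nearestDist x i ω) *
        expNeg (∑' p : Tier × ℕ, if p = (i, nearestIdx x i ω) then 0
          else logGain α (c p.1) ‖x p.1 p.2 ω‖) ∂μ =
      ∫⁻ r in Ioi (0 : ℝ), φ r * ENNReal.ofReal (2 * Real.pi * lam i * r *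
        Real.exp (-laplaceExponent α (lam i) (c i) r) *
        Real.exp (-laplaceExponent α (lam k) (c k) (a * r))) := by
  -- The coordinate process on sequences of points, with the tier label ignored: it exhibits
  -- `nearestDist` and `nearestIdx` as measurable functions of one tier's configuration.
  let x' : Tier → ℕ → (ℕ → Plane) → Plane := fun _ j y => y j
  have hx' (i : Tier) (j : ℕ) : Measurable (x' i j) := measurable_pi_apply j
  have hR' := measurable_nearestDist hx' i
  have hI' := measurable_nearestIdx hx' i
  let Φ₁ : (ℕ → Plane) → ℝ≥0∞ := fun y => φ (nearestDist x' i y) *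
    expNeg (∑' j, if j = nearestIdx x' i y then 0 else logGain α (c i) ‖y j‖)
  let Φ₂ : (ℕ → Plane) × (ℕ → Plane) → ℝ≥0∞ := fun p =>
    expNeg (∑' j, if a * nearestDist x' i p.1 < ‖p.2 j‖ then logGain α (c k) ‖p.2 j‖ else ∞)
  have hΦ₁ : Measurable Φ₁ := by
    refine (hφ.comp hR').mul (measurable_expNeg.comp (Measurable.tsum fun j =>
      Measurable.ite (measurableSet_eq_fun measurable_const hI') measurable_const ?_))
    exact (measurable_logGain _ _).comp (measurable_pi_apply j).norm
  have hΦ₂ : Measurable Φ₂ := by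
    refine measurable_expNeg.comp (Measurable.tsum fun j => Measurable.ite ?_ ?_ measurable_const)
    · exact measurableSet_lt ((hR'.comp measurable_fst).const_mul a)
        ((measurable_pi_apply j).comp measurable_snd).norm
    · exact (measurable_logGain _ _).comp ((measurable_pi_apply j).comp measurable_snd).norm
  have hXi : Measurable fun ω j => x i j ω := measurable_pi_lambda _ fun j => hx i j
  have hXk : Measurable fun ω j => x k j ω := measurable_pi_lambda _ fun j => hx k j
  have hS : MeasurableSet {ω | a * nearestDist x i ω < nearestDist x k ω} :=
    measurableSet_lt ((measurable_nearestDist hx i).const_mul a) (measurable_nearestDist hx k)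
  -- The exponent is known to be continuous only on `[0, ∞)`, hence `max r 0`.
  have hΛ : Continuous fun r => laplaceExponent α (lam k) (c k) (a * max r 0) :=
    (continuousOn_laplaceExponent hα (hc k)).comp_continuous (by fun_prop)
      fun r => mul_nonneg ha (le_max_right r 0)
  calc
    _ = ∫⁻ ω, Φ₁ (fun j => x i j ω) * Φ₂ (fun j => x i j ω, fun j => x k j ω) ∂μ := by
      rw [← lintegral_indicator hS]
      refine lintegral_congr_ae ?_
      filter_upwards [ae_finite_norm_le hx (hppp k)] with ω hω
      have h2 : Φ₂ (fun j => x i j ω, fun j => x k j ω) = _ :=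
        expNeg_tsum_exclusion hω (logGain α (c k)) (a * nearestDist x i ω)
      rw [h2]
      by_cases hlt : a * nearestDist x i ω < nearestDist x k ω
      · rw [indicator_of_mem (show ω ∈ {ω | a * nearestDist x i ω < nearestDist x k ω} from hlt),
          if_pos hlt, tsum_tier hik, expNeg_add, ← mul_assoc]
        have h3 : ∀ j, (k, j) ≠ (i, nearestIdx x i ω) := fun j h => hik (congrArg Prod.fst h).symm
        simp only [h3, if_false, Prod.mk.injEq, true_and]
        rfl
      · rw [indicator_of_notMem (show ω ∉ {ω | a * nearestDist x i ω < nearestDist x k ω} from hlt),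
          if_neg hlt, mul_zero]
    _ = ∫⁻ ω, Φ₁ (fun j => x i j ω) * ENNReal.ofReal (Real.exp
        (-laplaceExponent α (lam k) (c k) (a * nearestDist x i ω))) ∂μ := by
      rw [lintegral_comp_prodMk_of_indepFun hXi hXk hind
        (φ := fun p => Φ₁ p.1 * Φ₂ p) ((hΦ₁.comp measurable_fst).mul hΦ₂)]
      refine lintegral_congr fun ω => ?_
      refine (lintegral_const_mul (Φ₁ fun j => x i j ω)
        (f := fun ω' => Φ₂ (fun j => x i j ω, fun j => x k j ω'))
        ((hΦ₂.comp measurable_prodMk_left).comp hXk)).trans ?_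
      congr 1
      -- With tier `i` frozen, the exclusion radius `a * R_i` is a constant for tier `k`.
      exact lintegral_expNeg_tsum_exclusion hx (hppp k) hα (hlam k).le (hc k)
        (mul_nonneg ha nearestDist_nonneg)
    _ = _ := by
      have h1 := lintegral_nearestDist_mul_expNeg hx (hppp i) hα (hlam i) (hc i)
        (φ := fun r => φ r * ENNReal.ofReal (Real.exp
          (-laplaceExponent α (lam k) (c k) (a * max r 0))))
        (hφ.mul hΛ.measurable.neg.exp.ennreal_ofReal)
      refine Eq.trans (lintegral_congr fun ω => ?_) (h1.trans
        (setLIntegral_congr_fun measurableSet_Ioi fun r (hr : 0 < r) => ?_))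
      · rw [max_eq_left nearestDist_nonneg, mul_right_comm]
        rfl
      · rw [max_eq_left hr.le, mul_assoc, ← ENNReal.ofReal_mul (Real.exp_nonneg _)]
        congr 2
        ring

end Locations

/-! ### The association event and its closed forms -/

section Association

variable {Ω : Type*} [MeasurableSpace Ω] {μ : Measure Ω} {x : Tier → ℕ → Ω → Plane}
  {lam P : Tier → ℝ} {α : ℝ}

lemma exclusionRadius_self (i : Tier) (r : ℝ) : exclusionRadius α P i r i = r := by
  cases i <;> rfl

lemma exclusionRadius_eq_mul (i k : Tier) (r : ℝ) :
    exclusionRadius α P i r k = exclusionRadius α P i 1 k * r := by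
  cases i <;> cases k <;> simp [exclusionRadius]

lemma exclusionRadius_nonneg (i k : Tier) {r : ℝ} (hr : 0 ≤ r) :
    0 ≤ exclusionRadius α P i r k := by
  have : 0 ≤ omegaRatio P := Real.sqrt_nonneg _
  cases i <;> cases k <;> simp only [exclusionRadius] <;> positivity

lemma omegaRatio_pos (hP : ∀ i, 0 < P i) : 0 < omegaRatio P :=
  Real.sqrt_pos.2 (div_pos (hP _) (hP _))

lemma omegaRatio_rpow_rpow (hP : ∀ i, 0 < P i) (hα : 0 < α) :
    (omegaRatio P ^ (2 / α)) ^ α = P .mbs / P .sbs := by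
  rw [← Real.rpow_mul (omegaRatio_pos hP).le, div_mul_cancel₀ _ hα.ne', Real.rpow_two, omegaRatio,
    Real.sq_sqrt (div_pos (hP _) (hP _)).le]

lemma omegaRatio_rpow_sq (hP : ∀ i, 0 < P i) :
    (omegaRatio P ^ (2 / α)) ^ 2 = (P .mbs / P .sbs) ^ (2 / α) := by
  rw [← Real.rpow_two, ← Real.rpow_mul (omegaRatio_pos hP).le, mul_comm,
    Real.rpow_mul (omegaRatio_pos hP).le, Real.rpow_two, omegaRatio,
    Real.sq_sqrt (div_pos (hP _) (hP _)).le]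

lemma omegaRatio_rpow_neg (hP : ∀ i, 0 < P i) :
    omegaRatio P ^ (-2 / α) = (omegaRatio P ^ (2 / α))⁻¹ := by
  rw [neg_div, Real.rpow_neg (omegaRatio_pos hP).le]

lemma mul_rpow_neg_lt_iff (hP : ∀ i, 0 < P i) (hα : 0 < α) {u v : ℝ} (hu : 0 < u) (hv : 0 < v) :
    P .sbs * v ^ (-α) < P .mbs * u ^ (-α) ↔ u < omegaRatio P ^ (2 / α) * v := by
  have hq : 0 < omegaRatio P ^ (2 / α) := Real.rpow_pos_of_pos (omegaRatio_pos hP) _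
  have hu' : 0 < u ^ α := Real.rpow_pos_of_pos hu α
  have hv' : 0 < v ^ α := Real.rpow_pos_of_pos hv α
  have hs := hP .sbs
  rw [← Real.rpow_lt_rpow_iff hu.le (by positivity) hα, Real.mul_rpow hq.le hv.le,
    omegaRatio_rpow_rpow hP hα, Real.rpow_neg hu.le, Real.rpow_neg hv.le,
    ← div_eq_mul_inv, ← div_eq_mul_inv, div_lt_div_iff₀ hv' hu', div_mul_eq_mul_div,
    lt_div_iff₀ hs, mul_comm (u ^ α)]

/-- With tier `i` frozen, a tie puts a point of tier `k` on a fixed sphere, which is a null set. -/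
lemma ae_mul_nearestDist_ne [IsProbabilityMeasure μ] (hx : ∀ i j, Measurable (x i j)) {i k : Tier}
    (hind : IndepFun (fun ω j => x i j ω) (fun ω j => x k j ω) μ)
    (hppp : IsHomogeneousPPP μ (lam k) (x k)) (a : ℝ) :
    ∀ᵐ ω ∂μ, nearestDist x k ω ≠ a * nearestDist x i ω := by
  let x' : Tier → ℕ → (ℕ → Plane) → Plane := fun _ j y => y j
  have hx' (i : Tier) (j : ℕ) : Measurable (x' i j) := measurable_pi_apply j
  have hXi : Measurable fun ω j => x i j ω := measurable_pi_lambda _ fun j => hx i j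
  have hXk : Measurable fun ω j => x k j ω := measurable_pi_lambda _ fun j => hx k j
  have hS : MeasurableSet {p : (ℕ → Plane) × (ℕ → Plane) |
      nearestDist x' k p.2 = a * nearestDist x' i p.1} :=
    measurableSet_eq_fun ((measurable_nearestDist hx' k).comp measurable_snd)
      (((measurable_nearestDist hx' i).comp measurable_fst).const_mul a)
  have hT : MeasurableSet {ω | nearestDist x k ω = a * nearestDist x i ω} :=
    measurableSet_eq_fun (measurable_nearestDist hx k) ((measurable_nearestDist hx i).const_mul a)
  have h1 := lintegral_comp_prodMk_of_indepFun hXi hXk hind (φ := indicator _ 1)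
    (measurable_one.indicator hS)
  have h2 : ∫⁻ ω, indicator {ω | nearestDist x k ω = a * nearestDist x i ω} (1 : Ω → ℝ≥0∞) ω
      ∂μ = 0 := by
    refine Eq.trans h1 ((lintegral_congr (g := fun _ => 0) fun ω => ?_).trans lintegral_zero)
    refine (lintegral_congr_ae (g := fun _ => 0) ?_).trans lintegral_zero
    filter_upwards [ae_nearestDist_ne hx hppp (a * nearestDist x i ω)] with ω' hω'
    exact indicator_of_notMem (s := {p : (ℕ → Plane) × (ℕ → Plane) |
      nearestDist x' k p.2 = a * nearestDist x' i p.1}) (by exact hω') _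
  rw [lintegral_indicator_one hT] at h2
  exact measure_eq_zero_iff_ae_notMem.1 h2

/-- Discarding ties turns the weak inequality for `sbs` into a strict one, so both tiers take the
same empty-disc form. -/
lemma ae_mem_association_iff [IsProbabilityMeasure μ] (hx : ∀ i j, Measurable (x i j))
    (hP : ∀ i, 0 < P i) (hα : 0 < α) {i k : Tier} (hik : i ≠ k)
    (hind : IndepFun (fun ω j => x i j ω) (fun ω j => x k j ω) μ)
    (hppp : ∀ i, IsHomogeneousPPP μ (lam i) (x i)) :
    ∀ᵐ ω ∂μ, ω ∈ association α P x i ↔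
      exclusionRadius α P i 1 k * nearestDist x i ω < nearestDist x k ω := by
  have hq : 0 < omegaRatio P ^ (2 / α) := Real.rpow_pos_of_pos (omegaRatio_pos hP) _
  filter_upwards [ae_nearestDist_pos hx (hppp i), ae_nearestDist_pos hx (hppp k),
    ae_mul_nearestDist_ne hx hind (hppp k) (exclusionRadius α P i 1 k)] with ω hi hk hne
  cases i <;> cases k
  · exact absurd rfl hik
  · refine (mul_rpow_neg_lt_iff hP hα hi hk).trans ?_
    simp only [exclusionRadius, omegaRatio_rpow_neg hP, mul_one]
    rw [inv_mul_lt_iff₀ hq]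
  · refine not_lt.symm.trans ((mul_rpow_neg_lt_iff hP hα hk hi).not.trans ?_)
    simp only [exclusionRadius, mul_one] at hne ⊢
    rw [not_lt]
    exact ⟨fun h => h.lt_of_ne' hne, le_of_lt⟩
  · exact absurd rfl hik

/-- The closed form of the probability of association with each tier. -/
noncomputable def assocProb (α : ℝ) (lam P : Tier → ℝ) : Tier → ℝ
  | .mbs => 1 - sbsProb α lam P
  | .sbs => sbsProb α lam P

lemma assocProb_pos (hlam : ∀ i, 0 < lam i) (hP : ∀ i, 0 < P i) (i : Tier) :
    0 < assocProb α lam P i := by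
  have h1 := hlam .mbs
  have h2 := hlam .sbs
  have h3 : 0 < (P .mbs / P .sbs) ^ (2 / α) := Real.rpow_pos_of_pos (div_pos (hP _) (hP _)) _
  cases i
  · rw [assocProb, sbsProb, sub_pos, div_lt_one (by positivity), lt_add_iff_pos_right]
    positivity
  · rw [assocProb, sbsProb]
    positivity

lemma servingDensity_nonneg (hlam : ∀ i, 0 < lam i) (hP : ∀ i, 0 < P i) (i : Tier) {r : ℝ}
    (hr : 0 ≤ r) : 0 ≤ servingDensity α lam P i r := by
  have h1 := assocProb_pos (α := α) hlam hP i
  have h2 := hlam i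
  cases i <;> simp only [assocProb] at h1 <;> simp only [servingDensity] <;> positivity

lemma laplaceFormula_nonneg (d : Tier → ℝ) (s : ℝ) : 0 ≤ laplaceFormula α lam P d s :=
  Finset.prod_nonneg fun _ _ => Real.exp_nonneg _

lemma laplaceFormula_zero (hα : 0 < α) (d : Tier → ℝ) : laplaceFormula α lam P d 0 = 1 := by
  have : 2 / α ≠ 0 := by positivity
  simp [laplaceFormula, Real.zero_rpow this]

/-- The area terms of the two exponents, with the prefactor, make up `assocProb` times
`servingDensity`; the tail integrals make up `laplaceFormula`. -/
lemma assocProb_mul_servingDensity_mul_laplaceFormula (hlam : ∀ i, 0 < lam i) (hP : ∀ i, 0 < P i)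
    {i k : Tier} (hik : i ≠ k) (r s : ℝ) :
    assocProb α lam P i * (laplaceFormula α lam P (exclusionRadius α P i r) s *
      servingDensity α lam P i r) =
    2 * Real.pi * lam i * r * Real.exp (-laplaceExponent α (lam i) (s * P i) r) *
      Real.exp (-laplaceExponent α (lam k) (s * P k) (exclusionRadius α P i 1 k * r)) := by
  have hprod : laplaceFormula α lam P (exclusionRadius α P i r) s =
      Real.exp (-2 * Real.pi * lam i * (s * P i) ^ (2 / α) *
        tailIntegral ((s * P i) ^ (-1 / α) * r) α) *
      Real.exp (-2 * Real.pi * lam k * (s * P k) ^ (2 / α) *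
        tailIntegral ((s * P k) ^ (-1 / α) * (exclusionRadius α P i 1 k * r)) α) := by
    rw [laplaceFormula, Fintype.prod_eq_mul i k hik, exclusionRadius_self,
      exclusionRadius_eq_mul i k]
    rintro l ⟨h1, h2⟩
    cases i <;> cases k <;> cases l <;> simp_all
  have hdens : assocProb α lam P i * servingDensity α lam P i r = 2 * Real.pi * lam i * r *
      Real.exp (-Real.pi * (lam i * r ^ 2 + lam k * (exclusionRadius α P i 1 k * r) ^ 2)) := by
    have hp := (assocProb_pos (α := α) hlam hP i).ne'
    have hq2 := omegaRatio_rpow_sq (α := α) hP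
    have hinv : (P .sbs / P .mbs) ^ (2 / α) = ((P .mbs / P .sbs) ^ (2 / α))⁻¹ := by
      rw [← Real.inv_rpow (div_pos (hP _) (hP _)).le, inv_div]
    cases i <;> cases k
    · exact absurd rfl hik
    · simp only [assocProb] at hp
      simp only [assocProb, servingDensity, exclusionRadius, mul_pow, omegaRatio_rpow_neg hP,
        inv_pow, hq2, hinv, mul_one]
      rw [← mul_assoc, mul_div_cancel₀ _ hp]
      ring_nf
    · simp only [assocProb] at hp
      simp only [assocProb, servingDensity, exclusionRadius, mul_pow, hq2, mul_one]
      rw [← mul_assoc, mul_div_cancel₀ _ hp]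
      ring_nf
    · exact absurd rfl hik
  rw [mul_comm (laplaceFormula _ _ _ _ _), ← mul_assoc, hdens, hprod, laplaceExponent,
    laplaceExponent, mul_assoc _ (Real.exp _) (Real.exp _), mul_assoc _ (Real.exp _) (_ * _),
    ← Real.exp_add, ← Real.exp_add, ← Real.exp_add]
  congr 2
  ring

lemma setLIntegral_association_mul_expNeg [IsProbabilityMeasure μ]
    (hx : ∀ i j, Measurable (x i j))
    (hind : IndepFun (fun ω j => x .mbs j ω) (fun ω j => x .sbs j ω) μ)
    (hppp : ∀ i, IsHomogeneousPPP μ (lam i) (x i)) (hα : 2 < α) (hlam : ∀ i, 0 < lam i)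
    (hP : ∀ i, 0 < P i) (i : Tier) {s : ℝ} (hs : 0 ≤ s) {φ : ℝ → ℝ≥0∞} (hφ : Measurable φ) :
    ∫⁻ ω in association α P x i, φ (nearestDist x i ω) *
        expNeg (∑' p : Tier × ℕ, if p = (i, nearestIdx x i ω) then 0
          else logGain α (s * P p.1) ‖x p.1 p.2 ω‖) ∂μ =
      ∫⁻ r in Ioi (0 : ℝ), φ r * ENNReal.ofReal (assocProb α lam P i *
        (laplaceFormula α lam P (exclusionRadius α P i r) s * servingDensity α lam P i r)) := by
  obtain ⟨k, hik, hind'⟩ : ∃ k, i ≠ k ∧ IndepFun (fun ω j => x i j ω) (fun ω j => x k j ω) μ := by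
    cases i
    · exact ⟨.sbs, by simp, hind⟩
    · exact ⟨.mbs, by simp, hind.symm⟩
  have hset : association α P x i =ᵐ[μ]
      {ω | exclusionRadius α P i 1 k * nearestDist x i ω < nearestDist x k ω} :=
    eventuallyEq_set.2 (ae_mem_association_iff hx hP (by linarith) hik hind' hppp)
  rw [setLIntegral_congr hset, lintegral_indicator_lt_mul_expNeg hx hik hind' hppp hα hlam
    (c := fun i => s * P i) (fun i => mul_nonneg hs (hP i).le)
    (exclusionRadius_nonneg i k zero_le_one) hφ]
  simp_rw [assocProb_mul_servingDensity_mul_laplaceFormula hlam hP hik]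

end Association

/-! ### Quantities as functions of the configuration -/

section Configuration

variable {Ω : Type*} {x : Tier → ℕ → Ω → Plane} {h : Tier → ℕ → Ω → ℝ} {P : Tier → ℝ} {α : ℝ}

lemma indicator_association_comp {Ω' : Type*} (f : Ω' → Ω) (F : Ω → ℝ≥0∞) (i : Tier) (ω : Ω') :
    (association α P x i).indicator F (f ω) =
      (association α P (fun i j ω => x i j (f ω)) i).indicator (fun ω => F (f ω)) ω := by
  cases i <;> rfl

/-- Excluding the serving base station becomes a zero coefficient, the form used by
`lintegral_expNeg_tsum_gain` and `indepFun_tsum_gain`. -/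
lemma ofReal_mul_interference {s : ℝ} (hs : 0 ≤ s) (i : Tier) (ω : Ω) :
    ENNReal.ofReal s * interference α P x h i ω = ∑' p : Tier × ℕ, ENNReal.ofReal
      ((if p = (i, nearestIdx x i ω) then 0 else s * P p.1 * ‖x p.1 p.2 ω‖ ^ (-α)) *
        h p.1 p.2 ω) := by
  rw [interference, ← ENNReal.tsum_mul_left]
  refine tsum_congr fun p => ?_
  split_ifs
  · simp
  · rw [← ENNReal.ofReal_mul hs, receivedPower]
    congr 1
    ring

lemma lt_sinr_iff (hP : ∀ i, 0 < P i) {σ θ : ℝ} (hθ : 0 < θ) {i : Tier} {ω : Ω}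
    (hR : 0 < nearestDist x i ω) :
    ENNReal.ofReal θ < sinr α σ P x h i ω ↔
      ENNReal.ofReal ((P i)⁻¹ * θ * nearestDist x i ω ^ α) *
        (interference α P x h i ω + ENNReal.ofReal (σ ^ 2)) <
      ENNReal.ofReal (h i (nearestIdx x i ω) ω) := by
  have hPi := hP i
  have hRα : 0 < nearestDist x i ω ^ α := Real.rpow_pos_of_pos hR α
  have hu : 0 < P i * nearestDist x i ω ^ (-α) := mul_pos hPi (Real.rpow_pos_of_pos hR _)
  have h1 : receivedPower α P x h i (nearestIdx x i ω) ω =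
      P i * nearestDist x i ω ^ (-α) * h i (nearestIdx x i ω) ω := by
    rw [receivedPower, nearestDist]
    ring
  have h2 : θ = P i * nearestDist x i ω ^ (-α) * ((P i)⁻¹ * θ * nearestDist x i ω ^ α) := by
    rw [Real.rpow_neg hR.le]
    field_simp
  -- Since the threshold is neither `0` nor `∞`, the rearrangement holds even if interference plus
  -- noise is `0` or `∞`.
  rw [sinr, ENNReal.lt_div_iff_mul_lt (.inr ENNReal.ofReal_ne_top)
    (.inr (ENNReal.ofReal_pos.2 hθ).ne'), h1, ENNReal.ofReal_mul hu.le]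
  nth_rewrite 1 [h2]
  rw [ENNReal.ofReal_mul hu.le, mul_assoc,
    ENNReal.mul_lt_mul_iff_right (ENNReal.ofReal_pos.2 hu).ne' ENNReal.ofReal_ne_top]

end Configuration

/-! ### Averaging over the gains with the locations frozen -/

section Interference

variable {Ω : Type*} [MeasurableSpace Ω] {μ : Measure Ω} {x : Tier → ℕ → Ω → Plane}
  {h : Tier → ℕ → Ω → ℝ} {lam P : Tier → ℝ} {α : ℝ}

lemma measurable_locations (hx : ∀ i j, Measurable (x i j)) : Measurable fun ω i j => x i j ω :=
  measurable_pi_lambda _ fun i => measurable_pi_lambda _ fun j => hx i j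

lemma measurable_gains (hh : ∀ i j, Measurable (h i j)) : Measurable fun ω i j => h i j ω :=
  measurable_pi_lambda _ fun i => measurable_pi_lambda _ fun j => hh i j

/-- The locations `y` are deterministic; `Unit` serves as a trivial sample space for `nearestIdx`.
-/
lemma lintegral_expNeg_mul_interference (hh : ∀ i j, Measurable (h i j))
    (hlaw : ∀ i j, μ.map (h i j) = expMeasure 1)
    (hind : iIndepFun (fun k : Tier × ℕ => h k.1 k.2) μ) (hP : ∀ i, 0 < P i) {s : ℝ}
    (hs : 0 ≤ s) (i : Tier) (y : Tier → ℕ → Plane) :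
    ∫⁻ ω, expNeg (ENNReal.ofReal s * interference α P (fun i j _ => y i j) h i ω) ∂μ =
      expNeg (∑' p : Tier × ℕ, if p = (i, nearestIdx (fun i j (_ : Unit) => y i j) i ()) then 0
        else logGain α (s * P p.1) ‖y p.1 p.2‖) := by
  simp_rw [ofReal_mul_interference hs]
  have h1 := lintegral_expNeg_tsum_gain (fun p : Tier × ℕ => hh p.1 p.2) hind
    (fun p => hlaw p.1 p.2)
    (b := fun p => if p = (i, nearestIdx (fun i j (_ : Unit) => y i j) i ()) then 0
      else s * P p.1 * ‖y p.1 p.2‖ ^ (-α)) fun p => by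
        have := (hP p.1).le
        split_ifs <;> positivity
  refine h1.trans (congrArg _ (tsum_congr fun p => ?_))
  split_ifs <;> simp [logGain]

lemma lintegral_association_interference [IsProbabilityMeasure μ]
    (hnet : IsTwoTierNetwork μ lam x h) (hP : ∀ i, 0 < P i) (i : Tier) {s : ℝ} (hs : 0 ≤ s)
    {φ : ℝ → ℝ≥0∞} (hφ : Measurable φ) :
    ∫⁻ ω in association α P x i, φ (nearestDist x i ω) *
        expNeg (ENNReal.ofReal s * interference α P x h i ω) ∂μ =
      ∫⁻ ω in association α P x i, φ (nearestDist x i ω) *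
        expNeg (∑' p : Tier × ℕ, if p = (i, nearestIdx x i ω) then 0
          else logGain α (s * P p.1) ‖x p.1 p.2 ω‖) ∂μ := by
  have hx := hnet.measurable_location
  have hh := hnet.measurable_gain
  -- Coordinate processes on the space of pairs (locations, gains): every quantity of the model is
  -- pulled back from there, so Fubini can separate the two.
  let x' : Tier → ℕ → (Tier → ℕ → Plane) × (Tier → ℕ → ℝ) → Plane := fun i j p => p.1 i j
  let h' : Tier → ℕ → (Tier → ℕ → Plane) × (Tier → ℕ → ℝ) → ℝ := fun i j p => p.2 i j
  have hx' (i : Tier) (j : ℕ) : Measurable (x' i j) := by fun_prop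
  have hh' (i : Tier) (j : ℕ) : Measurable (h' i j) := by fun_prop
  have hA := measurableSet_association hx α P i
  have hA' := measurableSet_association hx' α P i
  let F : (Tier → ℕ → Plane) × (Tier → ℕ → ℝ) → ℝ≥0∞ := fun p =>
    φ (nearestDist x' i p) * expNeg (ENNReal.ofReal s * interference α P x' h' i p)
  let Φ : (Tier → ℕ → Plane) × (Tier → ℕ → ℝ) → ℝ≥0∞ := (association α P x' i).indicator F
  have hΦ : Measurable Φ := ((hφ.comp (measurable_nearestDist hx' i)).mul
    (measurable_expNeg.comp ((measurable_interference hx' hh' α P i).const_mul _))).indicator hA'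
  rw [← lintegral_indicator hA, ← lintegral_indicator hA]
  refine Eq.trans (lintegral_congr fun ω => (indicator_association_comp (x := x')
    (α := α) (P := P) (fun ω => (fun i j => x i j ω, fun i j => h i j ω)) F i ω).symm)
    ((lintegral_comp_prodMk_of_indepFun (measurable_locations hx) (measurable_gains hh)
    hnet.indep_location_gain hΦ).trans (lintegral_congr fun ω => ?_))
  by_cases hω : ω ∈ association α P x i
  · have h1 (ω' : Ω) : Φ (fun i j => x i j ω, fun i j => h i j ω') = φ (nearestDist x i ω) *
        expNeg (ENNReal.ofReal s * interference α P (fun i j _ => x i j ω) h i ω') := by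
      refine indicator_of_mem ?_ _
      cases i <;> exact hω
    simp_rw [h1]
    have hI : Measurable (interference α P (fun i j (_ : Ω) => x i j ω) h i) :=
      measurable_interference (fun _ _ => measurable_const) hh α P i
    rw [indicator_of_mem hω, lintegral_const_mul _ (by fun_prop), lintegral_expNeg_mul_interference hh hnet.gain_law hnet.indep_gain hP hs]
    rfl
  · have h1 (ω' : Ω) : Φ (fun i j => x i j ω, fun i j => h i j ω') = 0 := by
      refine indicator_of_notMem ?_ _
      cases i <;> exact hω
    simp [h1, hω]

/-- Given the locations, coverage says that the serving gain exceeds a multiple of interference plus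
noise, which involves only the other gains; `measure_lt_gain` then applies. -/
lemma measure_association_inter_coverage [IsProbabilityMeasure μ]
    (hnet : IsTwoTierNetwork μ lam x h) (hP : ∀ i, 0 < P i) (σ : ℝ) {θ : ℝ} (hθ : 0 < θ)
    (i : Tier) :
    μ (association α P x i ∩ {ω | ENNReal.ofReal θ < sinr α σ P x h i ω}) =
      ∫⁻ ω in association α P x i, expNeg (ENNReal.ofReal ((P i)⁻¹ * θ * nearestDist x i ω ^ α) *
        (interference α P x h i ω + ENNReal.ofReal (σ ^ 2))) ∂μ := by
  have hx := hnet.measurable_location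
  have hh := hnet.measurable_gain
  let x' : Tier → ℕ → (Tier → ℕ → Plane) × (Tier → ℕ → ℝ) → Plane := fun i j p => p.1 i j
  let h' : Tier → ℕ → (Tier → ℕ → Plane) × (Tier → ℕ → ℝ) → ℝ := fun i j p => p.2 i j
  have hx' (i : Tier) (j : ℕ) : Measurable (x' i j) := by fun_prop
  have hh' (i : Tier) (j : ℕ) : Measurable (h' i j) := by fun_prop
  have hA := measurableSet_association hx α P i
  have hA' := measurableSet_association hx' α P i
  have hS : MeasurableSet {ω | ENNReal.ofReal θ < sinr α σ P x h i ω} :=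
    measurableSet_lt measurable_const (measurable_sinr hx hh α σ P i)
  have hS' : MeasurableSet {p | ENNReal.ofReal θ < sinr α σ P x' h' i p} :=
    measurableSet_lt measurable_const (measurable_sinr hx' hh' α σ P i)
  let F : (Tier → ℕ → Plane) × (Tier → ℕ → ℝ) → ℝ≥0∞ :=
    {p | ENNReal.ofReal θ < sinr α σ P x' h' i p}.indicator 1
  let G : (Tier → ℕ → Plane) × (Tier → ℕ → ℝ) → ℝ≥0∞ := fun p =>
    expNeg (ENNReal.ofReal ((P i)⁻¹ * θ * nearestDist x' i p ^ α) *
        (interference α P x' h' i p + ENNReal.ofReal (σ ^ 2)))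
  let Φ : (Tier → ℕ → Plane) × (Tier → ℕ → ℝ) → ℝ≥0∞ := (association α P x' i).indicator F
  let Ψ : (Tier → ℕ → Plane) × (Tier → ℕ → ℝ) → ℝ≥0∞ := (association α P x' i).indicator G
  have hΦ : Measurable Φ := (measurable_one.indicator hS').indicator hA'
  have hΨ : Measurable Ψ := (measurable_expNeg.comp
    ((((measurable_nearestDist hx' i).pow_const _).const_mul _).ennreal_ofReal.mul
      ((measurable_interference hx' hh' α P i).add_const _))).indicator hA'
  have hl : μ (association α P x i ∩ {ω | ENNReal.ofReal θ < sinr α σ P x h i ω}) =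
      ∫⁻ ω, Φ (fun i j => x i j ω, fun i j => h i j ω) ∂μ := by
    rw [← lintegral_indicator_one (hA.inter hS)]
    refine lintegral_congr fun ω => ?_
    rw [← indicator_indicator]
    exact (indicator_association_comp (x := x') (α := α) (P := P)
      (fun ω => (fun i j => x i j ω, fun i j => h i j ω)) F i ω).symm
  rw [hl, ← lintegral_indicator hA, lintegral_comp_prodMk_of_indepFun (measurable_locations hx)
    (measurable_gains hh) hnet.indep_location_gain hΦ]
  refine Eq.trans ?_ ((lintegral_comp_prodMk_of_indepFun (measurable_locations hx)
    (measurable_gains hh) hnet.indep_location_gain hΨ).symm.trans (lintegral_congr fun ω =>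
      indicator_association_comp (x := x') (α := α) (P := P)
        (fun ω => (fun i j => x i j ω, fun i j => h i j ω)) G i ω))
  refine lintegral_congr_ae ?_
  filter_upwards [ae_nearestDist_pos hx (hnet.poisson i)] with ω hR
  by_cases hω : ω ∈ association α P x i
  · have hmem (ω' : Ω) : ((fun i j => x i j ω, fun i j => h i j ω') :
        (Tier → ℕ → Plane) × (Tier → ℕ → ℝ)) ∈ association α P x' i := by
      cases i <;> exact hω
    let y : Tier → ℕ → Ω → Plane := fun i j _ => x i j ω
    set t := (P i)⁻¹ * θ * nearestDist x i ω ^ α with ht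
    let Y : Ω → ℝ≥0∞ := fun ω' =>
      ENNReal.ofReal t * (interference α P y h i ω' + ENNReal.ofReal (σ ^ 2))
    have hI : Measurable (interference α P y h i) :=
      measurable_interference (fun _ _ => measurable_const) hh α P i
    have hY : Measurable Y := (hI.add_const _).const_mul _
    have hind : IndepFun Y (h i (nearestIdx x i ω)) μ := by
      have h1 := indepFun_tsum_gain (fun p : Tier × ℕ => hh p.1 p.2) hnet.indep_gain
        (b := fun p => if p = (i, nearestIdx x i ω) then 0
          else 1 * P p.1 * ‖x p.1 p.2 ω‖ ^ (-α)) (k₀ := (i, nearestIdx x i ω)) (if_pos rfl)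
      have h2 : (fun ω' => ∑' p : Tier × ℕ, ENNReal.ofReal
          ((if p = (i, nearestIdx x i ω) then 0 else 1 * P p.1 * ‖x p.1 p.2 ω‖ ^ (-α)) *
            h p.1 p.2 ω')) = interference α P y h i := by
        ext ω'
        rw [← one_mul (interference α P y h i ω'), ← ENNReal.ofReal_one,
          ofReal_mul_interference zero_le_one]
        rfl
      rw [h2] at h1
      exact h1.comp (φ := fun v => ENNReal.ofReal t * (v + ENNReal.ofReal (σ ^ 2)))
        (ψ := id) (by fun_prop) measurable_id
    have h1 (ω' : Ω) : Φ (fun i j => x i j ω, fun i j => h i j ω') =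
        {ω' | Y ω' < ENNReal.ofReal (h i (nearestIdx x i ω) ω')}.indicator 1 ω' := by
      refine (indicator_of_mem (hmem ω') _).trans ?_
      have h3 := lt_sinr_iff (x := y) (h := h) (α := α) (σ := σ) hP hθ (i := i) (ω := ω') hR
      by_cases h4 : ENNReal.ofReal θ < sinr α σ P y h i ω'
      · exact (indicator_of_mem (s := {p | ENNReal.ofReal θ < sinr α σ P x' h' i p})
          (by exact h4) _).trans (indicator_of_mem
            (s := {ω' | Y ω' < ENNReal.ofReal (h i (nearestIdx x i ω) ω')}) (by exact h3.1 h4)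
            (1 : Ω → ℝ≥0∞)).symm
      · exact (indicator_of_notMem (s := {p | ENNReal.ofReal θ < sinr α σ P x' h' i p})
          (by exact h4) _).trans (indicator_of_notMem
            (s := {ω' | Y ω' < ENNReal.ofReal (h i (nearestIdx x i ω) ω')})
            (by exact mt h3.2 h4) (1 : Ω → ℝ≥0∞)).symm
    have h2 (ω' : Ω) : Ψ (fun i j => x i j ω, fun i j => h i j ω') = expNeg (Y ω') :=
      indicator_of_mem (hmem ω') _
    simp_rw [h1, h2]
    rw [lintegral_indicator_one (measurableSet_lt hY (hh _ _).ennreal_ofReal),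
      measure_lt_gain (hh _ _) (hnet.gain_law _ _) hY hind]
  · have hmem (ω' : Ω) : ((fun i j => x i j ω, fun i j => h i j ω') :
        (Tier → ℕ → Plane) × (Tier → ℕ → ℝ)) ∉ association α P x' i := by
      cases i <;> exact hω
    have h1 (ω' : Ω) : Φ (fun i j => x i j ω, fun i j => h i j ω') = 0 :=
      indicator_of_notMem (hmem ω') _
    have h2 (ω' : Ω) : Ψ (fun i j => x i j ω, fun i j => h i j ω') = 0 :=
      indicator_of_notMem (hmem ω') _
    simp_rw [h1, h2]

end Interference

/-! ### Almost sure finiteness of the interference -/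

section Finiteness

variable {Ω : Type*} [MeasurableSpace Ω] {μ : Measure Ω} {x : Tier → ℕ → Ω → Plane}
  {h : Tier → ℕ → Ω → ℝ} {lam P : Tier → ℝ} {α : ℝ}

/-- The Laplace transform of the total power received from one tier. -/
lemma lintegral_expNeg_mul_tsum_receivedPower [IsProbabilityMeasure μ]
    (hnet : IsTwoTierNetwork μ lam x h) (hα : 2 < α) (hlam : ∀ i, 0 < lam i) (hP : ∀ i, 0 < P i)
    (k : Tier) {s : ℝ} (hs : 0 ≤ s) :
    ∫⁻ ω, expNeg (ENNReal.ofReal s * ∑' j, ENNReal.ofReal (receivedPower α P x h k j ω)) ∂μ =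
      ENNReal.ofReal (Real.exp (-laplaceExponent α (lam k) (s * P k) 0)) := by
  have hx := hnet.measurable_location
  have hh := hnet.measurable_gain
  have hPk := (hP k).le
  let x' : Tier → ℕ → (Tier → ℕ → Plane) × (Tier → ℕ → ℝ) → Plane := fun i j p => p.1 i j
  let h' : Tier → ℕ → (Tier → ℕ → Plane) × (Tier → ℕ → ℝ) → ℝ := fun i j p => p.2 i j
  have hx' (i : Tier) (j : ℕ) : Measurable (x' i j) := by fun_prop
  have hh' (i : Tier) (j : ℕ) : Measurable (h' i j) := by fun_prop
  let Φ : (Tier → ℕ → Plane) × (Tier → ℕ → ℝ) → ℝ≥0∞ := fun p =>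
    expNeg (ENNReal.ofReal s * ∑' j, ENNReal.ofReal (receivedPower α P x' h' k j p))
  have hΦ : Measurable Φ := measurable_expNeg.comp (Measurable.const_mul (Measurable.tsum fun j =>
    (measurable_receivedPower hx' hh' α P k j).ennreal_ofReal) _)
  refine (lintegral_comp_prodMk_of_indepFun (measurable_locations hx) (measurable_gains hh)
    hnet.indep_location_gain hΦ).trans ?_
  -- Almost surely no point lies at the origin, so the exclusion disc of radius `0` imposes nothing.
  rw [← lintegral_expNeg_tsum_exclusion hx (hnet.poisson k) hα (hlam k).le
    (mul_nonneg hs hPk) le_rfl]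
  refine lintegral_congr_ae ?_
  filter_upwards [ae_finite_norm_le hx (hnet.poisson k), ae_nearestDist_pos hx (hnet.poisson k)]
    with ω hfin hpos
  simp only [(lt_nearestDist_iff hfin).1 hpos, if_true]
  have h1 := lintegral_expNeg_tsum_gain (h := fun j => h k j) (hh k)
    (hnet.indep_gain.precomp (g := fun j : ℕ => (k, j)) (Prod.mk_right_injective k))
    (hnet.gain_law k) (b := fun j => s * P k * ‖x k j ω‖ ^ (-α)) fun j => by positivity
  refine Eq.trans (lintegral_congr fun ω' => congrArg expNeg ?_) h1
  rw [← ENNReal.tsum_mul_left]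
  refine tsum_congr fun j => ?_
  rw [← ENNReal.ofReal_mul hs, receivedPower]
  congr 1
  simp only [x', h']
  ring

/-- For `s > 0`, `E exp(-s T) ≤ P(T < ∞)`, and the left side tends to `1` as `s` decreases to `0`.
-/
lemma ae_tsum_receivedPower_ne_top [IsProbabilityMeasure μ]
    (hnet : IsTwoTierNetwork μ lam x h) (hα : 2 < α) (hlam : ∀ i, 0 < lam i) (hP : ∀ i, 0 < P i)
    (k : Tier) : ∀ᵐ ω ∂μ, ∑' j, ENNReal.ofReal (receivedPower α P x h k j ω) ≠ ∞ := by
  set T : Ω → ℝ≥0∞ := fun ω => ∑' j, ENNReal.ofReal (receivedPower α P x h k j ω) with hT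
  have hTm : Measurable T := Measurable.tsum fun j =>
    (measurable_receivedPower hnet.measurable_location hnet.measurable_gain α P k j).ennreal_ofReal
  have hS : MeasurableSet {ω | T ω ≠ ∞} := hTm (measurableSet_singleton _).compl
  have hle {s : ℝ} (hs : 0 < s) :
      ENNReal.ofReal (Real.exp (-laplaceExponent α (lam k) (s * P k) 0)) ≤ μ {ω | T ω ≠ ∞} := by
    rw [← lintegral_expNeg_mul_tsum_receivedPower hnet hα hlam hP k hs.le,
      ← lintegral_indicator_one hS]
    refine lintegral_mono fun ω => ?_
    by_cases hω : T ω = ∞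
    · have : ENNReal.ofReal s * T ω = ∞ := by
        rw [hω, ENNReal.mul_top (ENNReal.ofReal_pos.2 hs).ne']
      simp only [hT] at this
      simp [this]
    · rw [indicator_of_mem (by exact hω)]
      exact expNeg_le_one _
  -- At radius `0` the tail integral is taken at `0` whatever `s` is, so only `(s * P k) ^ (2 / α)`
  -- varies.
  have hcont : Continuous fun s : ℝ =>
      ENNReal.ofReal (Real.exp (-laplaceExponent α (lam k) (s * P k) 0)) := by
    have : Continuous fun s : ℝ => (s * P k) ^ (2 / α) :=
      (Real.continuous_rpow_const (by positivity)).comp (by fun_prop)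
    simp only [laplaceExponent, mul_zero]
    exact ENNReal.continuous_ofReal.comp (by fun_prop)
  have hlim := hcont.tendsto 0
  have hne : 2 / α ≠ 0 := by positivity
  simp only [laplaceExponent, zero_mul, Real.zero_rpow hne, mul_zero] at hlim
  have h1 : 1 ≤ μ {ω | T ω ≠ ∞} := by
    refine le_of_tendsto (f := fun s : ℝ =>
      ENNReal.ofReal (Real.exp (-laplaceExponent α (lam k) (s * P k) 0))) (x := 𝓝[>] 0) ?_ ?_
    · simpa [laplaceExponent] using hlim.mono_left nhdsWithin_le_nhds
    · filter_upwards [self_mem_nhdsWithin] with s hs using hle hs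
  exact (prob_compl_eq_zero_iff hS).2 (le_antisymm prob_le_one h1)

lemma ae_interference_ne_top [IsProbabilityMeasure μ] (hnet : IsTwoTierNetwork μ lam x h)
    (hα : 2 < α) (hlam : ∀ i, 0 < lam i) (hP : ∀ i, 0 < P i) (i : Tier) :
    ∀ᵐ ω ∂μ, interference α P x h i ω ≠ ∞ := by
  filter_upwards [ae_tsum_receivedPower_ne_top hnet hα hlam hP .mbs,
    ae_tsum_receivedPower_ne_top hnet hα hlam hP .sbs] with ω hm hs
  refine ne_top_of_le_ne_top (ENNReal.add_ne_top.2 ⟨hm, hs⟩) ?_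
  rw [← tsum_tier (by simp : Tier.mbs ≠ Tier.sbs)
    (fun p => ENNReal.ofReal (receivedPower α P x h p.1 p.2 ω))]
  refine ENNReal.tsum_le_tsum fun p => ?_
  split_ifs
  · exact zero_le
  · exact le_rfl

end Finiteness

/-! ### Regularity and normalisation of the closed forms -/

section ClosedForms

variable {lam P : Tier → ℝ} {α : ℝ}

lemma laplaceFormula_le_one (hlam : ∀ i, 0 < lam i) (hP : ∀ i, 0 < P i) (i : Tier) {r s : ℝ}
    (hr : 0 ≤ r) (hs : 0 ≤ s) : laplaceFormula α lam P (exclusionRadius α P i r) s ≤ 1 := by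
  refine Finset.prod_le_one (fun _ _ => Real.exp_nonneg _) fun k _ => ?_
  have h1 := tailIntegral_nonneg (α := α) (y := (s * P k) ^ (-1 / α) * exclusionRadius α P i r k)
    (mul_nonneg (Real.rpow_nonneg (mul_nonneg hs (hP k).le) _) (exclusionRadius_nonneg i k hr))
  have h2 := Real.rpow_nonneg (mul_nonneg hs (hP k).le) (2 / α)
  have h3 := hlam k
  rw [Real.exp_le_one_iff]
  have : 0 ≤ 2 * Real.pi * lam k * (s * P k) ^ (2 / α) *
      tailIntegral ((s * P k) ^ (-1 / α) * exclusionRadius α P i r k) α := by positivity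
  linarith

lemma continuousOn_laplaceFormula (hα : 2 < α) (hP : ∀ i, 0 < P i) (i : Tier) :
    ContinuousOn (fun p : ℝ × ℝ => laplaceFormula α lam P (exclusionRadius α P i p.1) p.2)
      (Ioi 0 ×ˢ Ioi 0) := by
  refine continuousOn_finsetProd _ fun k _ => ContinuousOn.rexp (ContinuousOn.mul ?_ ?_)
  · refine continuousOn_const.mul (ContinuousOn.rpow_const (by fun_prop) fun p hp => .inl ?_)
    exact (mul_pos hp.2 (hP k)).ne'
  · refine (continuousOn_tailIntegral hα).comp (ContinuousOn.mul (ContinuousOn.rpow_const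
      (by fun_prop) fun p hp => .inl (mul_pos hp.2 (hP k)).ne') ?_) fun p hp => ?_
    · have h1 : (fun p : ℝ × ℝ => exclusionRadius α P i p.1 k) =
          fun p => exclusionRadius α P i 1 k * p.1 := by
        ext p
        rw [exclusionRadius_eq_mul]
      rw [h1]
      fun_prop
    · exact mul_nonneg (Real.rpow_nonneg (mul_nonneg (le_of_lt hp.2) (hP k).le) _)
        (exclusionRadius_nonneg i k (le_of_lt hp.1))

lemma tendsto_laplaceFormula (hα : 2 < α) (hP : ∀ i, 0 < P i) (i : Tier) {r s : ℝ} (hr : 0 < r)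
    (hs : 0 < s) {u : ℕ → ℝ} (hu : Tendsto u atTop (𝓝 s)) :
    Tendsto (fun n => laplaceFormula α lam P (exclusionRadius α P i r) (u n)) atTop
      (𝓝 (laplaceFormula α lam P (exclusionRadius α P i r) s)) := by
  have h1 : ContinuousOn (fun s => laplaceFormula α lam P (exclusionRadius α P i r) s) (Ioi 0) :=
    (continuousOn_laplaceFormula hα hP i).comp (f := fun s => (r, s)) (by fun_prop)
      fun s hs => ⟨hr, hs⟩
  exact (h1.continuousAt (Ioi_mem_nhds hs)).tendsto.comp hu

lemma aemeasurable_laplaceFormula (hα : 2 < α) (hP : ∀ i, 0 < P i) (i : Tier) {s : ℝ → ℝ}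
    (hs : Measurable s) (hs0 : ∀ r, 0 < r → 0 < s r) :
    AEMeasurable (fun r => laplaceFormula α lam P (exclusionRadius α P i r) (s r))
      (volume.restrict (Ioi 0)) := by
  have h1 : Measurable ((Ioi 0 ×ˢ Ioi 0).piecewise
      (fun p : ℝ × ℝ => laplaceFormula α lam P (exclusionRadius α P i p.1) p.2) fun _ => 0) :=
    (continuousOn_laplaceFormula hα hP i).measurable_piecewise continuousOn_const
      (measurableSet_Ioi.prod measurableSet_Ioi)
  refine ⟨_, h1.comp (measurable_id.prodMk hs), ?_⟩
  filter_upwards [ae_restrict_mem measurableSet_Ioi] with r hr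
  have hp : (r, s r) ∈ Ioi (0 : ℝ) ×ˢ Ioi (0 : ℝ) := ⟨hr, hs0 r hr⟩
  exact (piecewise_eq_of_mem _ (fun p : ℝ × ℝ =>
    laplaceFormula α lam P (exclusionRadius α P i p.1) p.2) (fun _ => 0) hp).symm

lemma measurable_servingDensity (i : Tier) : Measurable (servingDensity α lam P i) := by
  cases i <;> unfold servingDensity <;> fun_prop

/-- The serving density is the nearest-point density of a single Poisson process of density `S`,
where `S` is `lam i` divided by the association probability. -/
lemma lintegral_servingDensity (hα : 2 < α) (hlam : ∀ i, 0 < lam i) (hP : ∀ i, 0 < P i)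
    (i : Tier) :
    ∫⁻ r in Ioi (0 : ℝ), ENNReal.ofReal (servingDensity α lam P i r) = 1 := by
  have hne : 2 / α ≠ 0 := by positivity
  have hm := hlam .mbs
  have hs := hlam .sbs
  have hq : 0 < (P .mbs / P .sbs) ^ (2 / α) := Real.rpow_pos_of_pos (div_pos (hP _) (hP _)) _
  have hinv : (P .sbs / P .mbs) ^ (2 / α) = ((P .mbs / P .sbs) ^ (2 / α))⁻¹ := by
    rw [← Real.inv_rpow (div_pos (hP _) (hP _)).le, inv_div]
  obtain ⟨S, hS, hd⟩ : ∃ S > 0, ∀ r, servingDensity α lam P i r =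
      2 * Real.pi * S * r * Real.exp (-(S * (Real.pi * r ^ 2))) := by
    cases i
    · refine ⟨lam .mbs + lam .sbs * ((P .mbs / P .sbs) ^ (2 / α))⁻¹, by positivity, fun r => ?_⟩
      have h1 : 0 < 1 - sbsProb α lam P := assocProb_pos hlam hP .mbs
      have h2 : lam .mbs / (1 - sbsProb α lam P) =
          lam .mbs + lam .sbs * ((P .mbs / P .sbs) ^ (2 / α))⁻¹ := by
        rw [div_eq_iff h1.ne', sbsProb]
        field_simp
        ring
      rw [servingDensity, hinv, ← h2]
      ring_nf
    · refine ⟨lam .sbs + lam .mbs * (P .mbs / P .sbs) ^ (2 / α), by positivity, fun r => ?_⟩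
      have h2 : lam .sbs / sbsProb α lam P =
          lam .sbs + lam .mbs * (P .mbs / P .sbs) ^ (2 / α) := by
        rw [sbsProb]
        field_simp
      rw [servingDensity, ← h2]
      ring_nf
  have h1 := lintegral_Ioi_nearest_density hα hS le_rfl (le_refl 0)
  simpa [laplaceExponent, Real.zero_rpow hne, hd] using h1

end ClosedForms

/-! ### Conditional laws given the association -/

section Conditional

variable {Ω : Type*} [MeasurableSpace Ω] {μ : Measure Ω} {x : Tier → ℕ → Ω → Plane}
  {h : Tier → ℕ → Ω → ℝ} {lam P : Tier → ℝ} {α : ℝ}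

/-- The central identity: the joint law of the serving distance and the Laplace weight of the
interference, on the association event. -/
lemma setLIntegral_association_interference [IsProbabilityMeasure μ]
    (hnet : IsTwoTierNetwork μ lam x h) (hα : 2 < α) (hlam : ∀ i, 0 < lam i) (hP : ∀ i, 0 < P i)
    (i : Tier) {s : ℝ} (hs : 0 ≤ s) {φ : ℝ → ℝ≥0∞} (hφ : Measurable φ) :
    ∫⁻ ω in association α P x i, φ (nearestDist x i ω) *
        expNeg (ENNReal.ofReal s * interference α P x h i ω) ∂μ =
      ENNReal.ofReal (assocProb α lam P i) * ∫⁻ r in Ioi (0 : ℝ), φ r * ENNReal.ofReal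
        (laplaceFormula α lam P (exclusionRadius α P i r) s * servingDensity α lam P i r) := by
  rw [lintegral_association_interference hnet hP i hs hφ,
    setLIntegral_association_mul_expNeg hnet.measurable_location hnet.indep_tiers hnet.poisson hα
      hlam hP i hs hφ, ← lintegral_const_mul' _ _ ENNReal.ofReal_ne_top]
  refine lintegral_congr fun r => ?_
  rw [ENNReal.ofReal_mul (assocProb_pos hlam hP i).le]
  ring

lemma measure_association [IsProbabilityMeasure μ] (hnet : IsTwoTierNetwork μ lam x h) (hα : 2 < α)
    (hlam : ∀ i, 0 < lam i) (hP : ∀ i, 0 < P i) (i : Tier) :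
    μ (association α P x i) = ENNReal.ofReal (assocProb α lam P i) := by
  have h1 := setLIntegral_association_interference hnet hα hlam hP i le_rfl
    (φ := fun _ => 1) measurable_const
  simpa [laplaceFormula_zero (by linarith : 0 < α), lintegral_servingDensity hα hlam hP] using h1

lemma isProbabilityMeasure_cond_association [IsProbabilityMeasure μ]
    (hnet : IsTwoTierNetwork μ lam x h) (hα : 2 < α) (hlam : ∀ i, 0 < lam i) (hP : ∀ i, 0 < P i)
    (i : Tier) : IsProbabilityMeasure (μ[|association α P x i]) := by
  refine cond_isProbabilityMeasure ?_
  rw [measure_association hnet hα hlam hP]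
  exact (ENNReal.ofReal_pos.2 (assocProb_pos hlam hP i)).ne'

lemma lintegral_cond_interference [IsProbabilityMeasure μ]
    (hnet : IsTwoTierNetwork μ lam x h) (hα : 2 < α) (hlam : ∀ i, 0 < lam i) (hP : ∀ i, 0 < P i)
    (i : Tier) {s : ℝ} (hs : 0 ≤ s) {φ : ℝ → ℝ≥0∞} (hφ : Measurable φ) :
    ∫⁻ ω, φ (nearestDist x i ω) * expNeg (ENNReal.ofReal s * interference α P x h i ω)
        ∂μ[|association α P x i] =
      ∫⁻ r in Ioi (0 : ℝ), φ r * ENNReal.ofReal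
        (laplaceFormula α lam P (exclusionRadius α P i r) s * servingDensity α lam P i r) := by
  rw [ProbabilityTheory.cond, lintegral_smul_measure, setLIntegral_association_interference hnet hα hlam hP i hs hφ,
    measure_association hnet hα hlam hP, smul_eq_mul, ← mul_assoc, ENNReal.inv_mul_cancel, one_mul]
  · exact (ENNReal.ofReal_pos.2 (assocProb_pos hlam hP i)).ne'
  · exact ENNReal.ofReal_ne_top

lemma lintegral_cond_nearestDist [IsProbabilityMeasure μ]
    (hnet : IsTwoTierNetwork μ lam x h) (hα : 2 < α) (hlam : ∀ i, 0 < lam i) (hP : ∀ i, 0 < P i)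
    (i : Tier) {φ : ℝ → ℝ≥0∞} (hφ : Measurable φ) :
    ∫⁻ ω, φ (nearestDist x i ω) ∂μ[|association α P x i] =
      ∫⁻ r in Ioi (0 : ℝ), φ r * ENNReal.ofReal (servingDensity α lam P i r) := by
  simpa [laplaceFormula_zero (by linarith : 0 < α)] using
    lintegral_cond_interference hnet hα hlam hP i le_rfl hφ

theorem map_nearestDist_cond [IsProbabilityMeasure μ]
    (hnet : IsTwoTierNetwork μ lam x h) (hα : 2 < α) (hlam : ∀ i, 0 < lam i) (hP : ∀ i, 0 < P i)
    (i : Tier) :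
    (μ[|association α P x i]).map (nearestDist x i) =
      (volume.restrict (Ioi (0 : ℝ))).withDensity
        fun r => ENNReal.ofReal (servingDensity α lam P i r) := by
  have hR := measurable_nearestDist hnet.measurable_location i
  refine Measure.ext_of_lintegral _ fun φ hφ => ?_
  rw [lintegral_map hφ hR, lintegral_cond_nearestDist hnet hα hlam hP i hφ,
    lintegral_withDensity_eq_lintegral_mul _ (measurable_servingDensity i).ennreal_ofReal hφ]
  simp only [Pi.mul_apply, mul_comm]

/-- The conditional Laplace transform of the interference, at an argument depending on the serving
distance through a function with countably many values. -/
lemma lintegral_cond_interference_countable [IsProbabilityMeasure μ]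
    (hnet : IsTwoTierNetwork μ lam x h) (hα : 2 < α) (hlam : ∀ i, 0 < lam i) (hP : ∀ i, 0 < P i)
    (i : Tier) {N : ℝ → ℕ} (hN : Measurable N) {τ : ℕ → ℝ} (hτ : ∀ m, 0 < τ m)
    {φ : ℝ → ℝ≥0∞} (hφ : Measurable φ) :
    ∫⁻ ω, φ (nearestDist x i ω) * expNeg (ENNReal.ofReal (τ (N (nearestDist x i ω))) *
        interference α P x h i ω) ∂μ[|association α P x i] =
      ∫⁻ r in Ioi (0 : ℝ), φ r * ENNReal.ofReal (laplaceFormula α lam P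
        (exclusionRadius α P i r) (τ (N r)) * servingDensity α lam P i r) := by
  have hR := measurable_nearestDist hnet.measurable_location i
  have hI := measurable_interference hnet.measurable_location hnet.measurable_gain α P i
  have hS (m : ℕ) : MeasurableSet (N ⁻¹' {m}) := hN (measurableSet_singleton m)
  -- On each level set of `N` the Laplace argument is a constant.
  have hsplit (F : ℕ → ℝ≥0∞) (r : ℝ) :
      φ r * F (N r) = ∑' m, (N ⁻¹' {m}).indicator φ r * F m := by
    rw [tsum_eq_single (N r)]
    · rw [indicator_of_mem (s := N ⁻¹' {N r}) (by exact rfl)]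
    · intro m hm
      rw [indicator_of_notMem (s := N ⁻¹' {m}) (by exact hm.symm), zero_mul]
  have h1 (ω : Ω) := hsplit (fun m => expNeg (ENNReal.ofReal (τ m) * interference α P x h i ω))
    (nearestDist x i ω)
  have h2 (r : ℝ) := hsplit (fun m => ENNReal.ofReal (laplaceFormula α lam P
    (exclusionRadius α P i r) (τ m) * servingDensity α lam P i r)) r
  simp_rw [h1, h2]
  rw [lintegral_tsum, lintegral_tsum]
  · exact tsum_congr fun m =>
      lintegral_cond_interference hnet hα hlam hP i (hτ m).le (hφ.indicator (hS m))
  · intro m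
    exact (hφ.indicator (hS m)).aemeasurable.mul ((aemeasurable_laplaceFormula hα hP i
      measurable_const fun _ _ => hτ m).mul (measurable_servingDensity i).aemeasurable).ennreal_ofReal
  · intro m
    exact (((hφ.indicator (hS m)).comp hR).mul
      (measurable_expNeg.comp (hI.const_mul _))).aemeasurable

/-- A Laplace argument varying with the serving distance is needed for coverage. It is a limit of
countably valued ones, and dominated convergence applies on both sides. -/
lemma lintegral_cond_interference_comp [IsProbabilityMeasure μ]
    (hnet : IsTwoTierNetwork μ lam x h) (hα : 2 < α) (hlam : ∀ i, 0 < lam i) (hP : ∀ i, 0 < P i)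
    (i : Tier) {t : ℝ → ℝ} (ht : Measurable t) (ht0 : ∀ r, 0 < r → 0 < t r)
    {φ : ℝ → ℝ≥0∞} (hφ : Measurable φ) (hφ1 : ∀ r, φ r ≤ 1) :
    ∫⁻ ω, φ (nearestDist x i ω) * expNeg (ENNReal.ofReal (t (nearestDist x i ω)) *
        interference α P x h i ω) ∂μ[|association α P x i] =
      ∫⁻ r in Ioi (0 : ℝ), φ r * ENNReal.ofReal (laplaceFormula α lam P
        (exclusionRadius α P i r) (t r) * servingDensity α lam P i r) := by
  have hx := hnet.measurable_location
  have hR := measurable_nearestDist hx i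
  have hI := measurable_interference hx hnet.measurable_gain α P i
  have hprob := isProbabilityMeasure_cond_association hnet hα hlam hP i
  let N (n : ℕ) (r : ℝ) : ℕ := ⌊t r * (n + 1 : ℕ)⌋₊
  -- The `+ 1` in the numerator keeps the approximations positive, where `laplaceFormula` is known
  -- to be continuous; it adds only `1 / (n + 1)`.
  let τ (n m : ℕ) : ℝ := (m + 1 : ℕ) / (n + 1 : ℕ)
  have hN (n : ℕ) : Measurable (N n) := Nat.measurable_floor.comp (ht.mul_const _)
  have hτ (n m : ℕ) : 0 < τ n m := by positivity
  have hlim (r : ℝ) (hr : 0 < r) : Tendsto (fun n => τ n (N n r)) atTop (𝓝 (t r)) := by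
    have h1 := (tendsto_nat_floor_mul_div_atTop (ht0 r hr).le).comp
      (tendsto_natCast_atTop_atTop.comp (tendsto_add_atTop_nat 1))
    have h2 := h1.add tendsto_one_div_add_atTop_nhds_zero_nat
    rw [add_zero] at h2
    refine h2.congr fun n => ?_
    simp [τ, N, add_div]
  have hae : ∀ᵐ ω ∂μ[|association α P x i],
      0 < nearestDist x i ω ∧ interference α P x h i ω ≠ ∞ :=
    cond_absolutelyContinuous.ae_le ((ae_nearestDist_pos hx (hnet.poisson i)).and
      (ae_interference_ne_top hnet hα hlam hP i))
  have hl : Tendsto (fun n => ∫⁻ ω, φ (nearestDist x i ω) * expNeg (ENNReal.ofReal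
      (τ n (N n (nearestDist x i ω))) * interference α P x h i ω) ∂μ[|association α P x i]) atTop
      (𝓝 (∫⁻ ω, φ (nearestDist x i ω) * expNeg (ENNReal.ofReal (t (nearestDist x i ω)) *
        interference α P x h i ω) ∂μ[|association α P x i])) := by
    refine tendsto_lintegral_of_dominated_convergence (fun _ => 1) (fun n => ?_)
      (fun n => ae_of_all _ fun ω => mul_le_one' (hφ1 _) (expNeg_le_one _)) (by simp) ?_
    · have : Measurable fun ω => τ n (N n (nearestDist x i ω)) :=
        (measurable_of_countable (τ n)).comp ((hN n).comp hR)
      exact (hφ.comp hR).mul (measurable_expNeg.comp (this.ennreal_ofReal.mul hI))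
    · filter_upwards [hae] with ω hω
      -- Multiplication by the interference preserves the limit because the interference is finite.
      refine ENNReal.Tendsto.const_mul ((continuous_expNeg.tendsto _).comp
        (ENNReal.Tendsto.mul_const ((ENNReal.continuous_ofReal.tendsto _).comp
          (hlim _ hω.1)) (.inr hω.2))) (.inr ?_)
      exact ne_top_of_le_ne_top ENNReal.one_ne_top (hφ1 _)
  have hr : Tendsto (fun n => ∫⁻ r in Ioi (0 : ℝ), φ r * ENNReal.ofReal (laplaceFormula α lam P
      (exclusionRadius α P i r) (τ n (N n r)) * servingDensity α lam P i r)) atTop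
      (𝓝 (∫⁻ r in Ioi (0 : ℝ), φ r * ENNReal.ofReal (laplaceFormula α lam P
        (exclusionRadius α P i r) (t r) * servingDensity α lam P i r))) := by
    refine tendsto_lintegral_of_dominated_convergence'
      (fun r => ENNReal.ofReal (servingDensity α lam P i r)) (fun n => ?_) (fun n => ?_)
      (by rw [lintegral_servingDensity hα hlam hP]; simp) ?_
    · exact hφ.aemeasurable.mul ((aemeasurable_laplaceFormula hα hP i
        ((measurable_of_countable (τ n)).comp (hN n)) fun _ _ => hτ n _).mul
          (measurable_servingDensity i).aemeasurable).ennreal_ofReal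
    · filter_upwards [ae_restrict_mem measurableSet_Ioi] with r (hr : 0 < r)
      refine (mul_le_of_le_one_left' (hφ1 r)).trans (ENNReal.ofReal_le_ofReal ?_)
      exact mul_le_of_le_one_left (servingDensity_nonneg hlam hP i hr.le)
        (laplaceFormula_le_one hlam hP i hr.le (hτ n _).le)
    · filter_upwards [ae_restrict_mem measurableSet_Ioi] with r (hr : 0 < r)
      refine ENNReal.Tendsto.const_mul ((ENNReal.continuous_ofReal.tendsto _).comp
        (Tendsto.mul_const _ ?_)) (.inr (ne_top_of_le_ne_top ENNReal.one_ne_top (hφ1 _)))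
      exact tendsto_laplaceFormula hα hP i hr (ht0 r hr) (hlim r hr)
  refine tendsto_nhds_unique (hl.congr fun n => ?_) hr
  exact lintegral_cond_interference_countable hnet hα hlam hP i (hN n) (hτ n) hφ

/-- The conditional Laplace transform of the interference given the serving distance. -/
theorem condExp_exp_neg_interference [IsProbabilityMeasure μ]
    (hnet : IsTwoTierNetwork μ lam x h) (hα : 2 < α) (hlam : ∀ i, 0 < lam i) (hP : ∀ i, 0 < P i)
    (i : Tier) {s : ℝ} (hs : 0 < s) :
    (μ[|association α P x i])[fun ω => Real.exp (-(s * (interference α P x h i ω).toReal)) |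
        MeasurableSpace.comap (nearestDist x i) inferInstance]
      =ᵐ[μ[|association α P x i]]
    fun ω => laplaceFormula α lam P (exclusionRadius α P i (nearestDist x i ω)) s := by
  have hx := hnet.measurable_location
  have hR := measurable_nearestDist hx i
  have hI := measurable_interference hx hnet.measurable_gain α P i
  have hprob := isProbabilityMeasure_cond_association hnet hα hlam hP i
  set ν := μ[|association α P x i] with hν
  have hae : ∀ᵐ ω ∂ν, 0 < nearestDist x i ω ∧ interference α P x h i ω ≠ ∞ :=
    cond_absolutelyContinuous.ae_le ((ae_nearestDist_pos hx (hnet.poisson i)).and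
      (ae_interference_ne_top hnet hα hlam hP i))
  -- Cutting off to positive distances makes the function measurable on the line; almost surely
  -- nothing changes.
  let L : ℝ → ℝ := (Ioi 0).indicator fun r => laplaceFormula α lam P (exclusionRadius α P i r) s
  have hLm : Measurable L := by
    classical
    have hc : ContinuousOn (fun r => laplaceFormula α lam P (exclusionRadius α P i r) s) (Ioi 0) :=
      (continuousOn_laplaceFormula hα hP i).comp (f := fun r => (r, s)) (by fun_prop)
        fun r hr => ⟨hr, hs⟩
    simpa only [piecewise_eq_indicator] using
      hc.measurable_piecewise (g := 0) continuousOn_const measurableSet_Ioi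
  have hL0 (r : ℝ) : 0 ≤ L r := indicator_nonneg (fun r _ => laplaceFormula_nonneg _ _) r
  have hL1 (r : ℝ) : L r ≤ 1 :=
    indicator_apply_le' (fun hr => laplaceFormula_le_one hlam hP i (le_of_lt hr) hs.le)
      fun _ => zero_le_one
  have hLR : (fun ω => laplaceFormula α lam P (exclusionRadius α P i (nearestDist x i ω)) s) =ᵐ[ν]
      fun ω => L (nearestDist x i ω) := by
    filter_upwards [hae] with ω hω
    exact (indicator_of_mem (s := Ioi 0) hω.1
      fun r => laplaceFormula α lam P (exclusionRadius α P i r) s).symm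
  have hfm : Measurable fun ω => Real.exp (-(s * (interference α P x h i ω).toReal)) :=
    (hI.ennreal_toReal.const_mul s).neg.exp
  have hf1 (ω : Ω) : Real.exp (-(s * (interference α P x h i ω).toReal)) ≤ 1 :=
    Real.exp_le_one_iff.2 (neg_nonpos.2 (mul_nonneg hs.le ENNReal.toReal_nonneg))
  have hfi : Integrable (fun ω => Real.exp (-(s * (interference α P x h i ω).toReal))) ν :=
    .of_bound hfm.aestronglyMeasurable 1 (ae_of_all _ fun ω => by
      rw [Real.norm_of_nonneg (Real.exp_nonneg _)]
      exact hf1 ω)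
  have hLi : Integrable (fun ω => L (nearestDist x i ω)) ν :=
    .of_bound (hLm.comp hR).aestronglyMeasurable 1 (ae_of_all _ fun ω => by
      rw [Real.norm_of_nonneg (hL0 _)]
      exact hL1 _)
  refine (hLR.trans (ae_eq_condExp_of_forall_setIntegral_eq hR.comap_le hfi
    (fun _ _ _ => hLi.integrableOn) ?_ ?_)).symm
  -- Events of the σ-algebra of the serving distance are preimages of Borel sets `B`, so testing
  -- with the indicator of `B` suffices.
  · rintro _ ⟨B, hB, rfl⟩ -
    have hRB := hR hB
    rw [integral_eq_lintegral_of_nonneg_ae (ae_of_all _ fun ω => hL0 _)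
        (hLm.comp hR).aestronglyMeasurable,
      integral_eq_lintegral_of_nonneg_ae (ae_of_all _ fun ω => Real.exp_nonneg _)
        hfm.aestronglyMeasurable, ← lintegral_indicator hRB, ← lintegral_indicator hRB]
    congr 1
    have h1 := lintegral_cond_interference hnet hα hlam hP i hs.le
      (φ := B.indicator 1) (measurable_one.indicator hB)
    have h2 := lintegral_cond_nearestDist hnet hα hlam hP i
      (φ := B.indicator fun r => ENNReal.ofReal (L r)) (hLm.ennreal_ofReal.indicator hB)
    calc _ = ∫⁻ r in Ioi (0 : ℝ), B.indicator (fun r => ENNReal.ofReal (L r)) r *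
          ENNReal.ofReal (servingDensity α lam P i r) := h2
      _ = ∫⁻ r in Ioi (0 : ℝ), (B.indicator 1 r : ℝ≥0∞) * ENNReal.ofReal
          (laplaceFormula α lam P (exclusionRadius α P i r) s * servingDensity α lam P i r) := by
        refine setLIntegral_congr_fun measurableSet_Ioi fun r hr => ?_
        by_cases hrB : r ∈ B
        · simp only [indicator_of_mem hrB, Pi.one_apply, one_mul, L, indicator_of_mem hr]
          rw [ENNReal.ofReal_mul (laplaceFormula_nonneg _ _)]
        · simp only [indicator_of_notMem hrB, zero_mul]
      _ = _ := h1.symm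
      _ = _ := by
        refine lintegral_congr_ae ?_
        filter_upwards [hae] with ω hω
        have h3 : ENNReal.ofReal s * interference α P x h i ω =
            ENNReal.ofReal (s * (interference α P x h i ω).toReal) := by
          rw [ENNReal.ofReal_mul hs.le, ENNReal.ofReal_toReal hω.2]
        rw [h3, expNeg_ofReal (mul_nonneg hs.le ENNReal.toReal_nonneg)]
        by_cases hωB : nearestDist x i ω ∈ B
        · rw [indicator_of_mem hωB, indicator_of_mem (by exact hωB), Pi.one_apply, one_mul]
        · rw [indicator_of_notMem hωB, indicator_of_notMem (by exact hωB), zero_mul]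
  · exact (hLm.comp (comap_measurable _)).aestronglyMeasurable

lemma coverageIntegrand_nonneg (hlam : ∀ i, 0 < lam i) (hP : ∀ i, 0 < P i) (σ θ : ℝ) (i : Tier)
    {r : ℝ} (hr : 0 ≤ r) : 0 ≤ coverageIntegrand α σ θ lam P i r :=
  mul_nonneg (mul_nonneg (Real.exp_nonneg _) (laplaceFormula_nonneg _ _))
    (servingDensity_nonneg hlam hP i hr)

lemma aemeasurable_coverageIntegrand (hα : 2 < α) (hP : ∀ i, 0 < P i) (σ : ℝ) {θ : ℝ}
    (hθ : 0 < θ) (i : Tier) :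
    AEMeasurable (coverageIntegrand α σ θ lam P i) (volume.restrict (Ioi 0)) := by
  have h1 : AEMeasurable (fun r => laplaceFormula α lam P (exclusionRadius α P i r)
      ((P i)⁻¹ * θ * r ^ α)) (volume.restrict (Ioi 0)) :=
    aemeasurable_laplaceFormula hα hP i (by fun_prop) fun r hr =>
      mul_pos (mul_pos (inv_pos.2 (hP i)) hθ) (Real.rpow_pos_of_pos hr α)
  exact (AEMeasurable.mul (by fun_prop) h1).mul (measurable_servingDensity i).aemeasurable

/-- The noise factor depends on the serving distance alone and is absorbed into the test function
`φ`. -/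
lemma lintegral_coverageIntegrand [IsProbabilityMeasure μ]
    (hnet : IsTwoTierNetwork μ lam x h) (hα : 2 < α) (hlam : ∀ i, 0 < lam i) (hP : ∀ i, 0 < P i)
    (σ : ℝ) {θ : ℝ} (hθ : 0 < θ) (i : Tier) :
    (μ[|association α P x i]) {ω | ENNReal.ofReal θ < sinr α σ P x h i ω} =
      ∫⁻ r in Ioi (0 : ℝ), ENNReal.ofReal (coverageIntegrand α σ θ lam P i r) := by
  have hPi := hP i
  have hA := measurableSet_association hnet.measurable_location α P i
  have hcov := measure_association_inter_coverage (α := α) hnet hP σ hθ i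
  have h1 := lintegral_cond_interference_comp hnet hα hlam hP i
    (t := fun r => (P i)⁻¹ * θ * r ^ α) (by fun_prop)
    (fun r hr => mul_pos (mul_pos (inv_pos.2 hPi) hθ) (Real.rpow_pos_of_pos hr α))
    (φ := fun r => expNeg (ENNReal.ofReal ((P i)⁻¹ * θ * r ^ α) * ENNReal.ofReal (σ ^ 2)))
    (by fun_prop) fun r => expNeg_le_one _
  rw [cond_apply hA, hcov]
  calc _ = ∫⁻ ω, expNeg (ENNReal.ofReal ((P i)⁻¹ * θ * nearestDist x i ω ^ α) *
        (interference α P x h i ω + ENNReal.ofReal (σ ^ 2))) ∂μ[|association α P x i] := by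
        rw [ProbabilityTheory.cond, lintegral_smul_measure, smul_eq_mul]
    _ = _ := by
      refine Eq.trans (lintegral_congr fun ω => ?_) (h1.trans
        (setLIntegral_congr_fun measurableSet_Ioi fun r (hr : 0 < r) => ?_))
      · rw [mul_add, expNeg_add, mul_comm]
      · have := Real.rpow_pos_of_pos hr α
        rw [← ENNReal.ofReal_mul (by positivity), expNeg_ofReal (by positivity),
          ← ENNReal.ofReal_mul (Real.exp_nonneg _), coverageIntegrand, ← mul_assoc]
        ring_nf

end Conditional

end TwoTier

theorem theorem1 {Ω : Type*} [MeasurableSpace Ω] (μ : Measure Ω) [IsProbabilityMeasure μ]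
    (lam P : Tier → ℝ) (hlam : ∀ i, 0 < lam i) (hP : ∀ i, 0 < P i)
    (α : ℝ) (hα : 2 < α) (σ θ : ℝ) (hθ : 0 < θ)
    (x : Tier → ℕ → Ω → TwoTier.Plane) (h : Tier → ℕ → Ω → ℝ)
    (hnet : TwoTier.IsTwoTierNetwork μ lam x h) :
    -- association probabilities
    μ.real (TwoTier.association α P x .sbs) = TwoTier.sbsProb α lam P ∧
    μ.real (TwoTier.association α P x .mbs) = 1 - TwoTier.sbsProb α lam P ∧
    ∀ i : Tier,
      -- conditional law of the serving distance
      (μ[|TwoTier.association α P x i]).map (TwoTier.nearestDist x i) =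
        (volume.restrict (Ioi (0 : ℝ))).withDensity
          (fun r => ENNReal.ofReal (TwoTier.servingDensity α lam P i r)) ∧
      -- the interference is finite, and its Laplace transform given the serving distance
      (∀ᵐ ω ∂μ, TwoTier.interference α P x h i ω ≠ ∞) ∧
      (∀ s : ℝ, 0 < s →
        (μ[|TwoTier.association α P x i])[
            (fun ω => Real.exp (-(s * (TwoTier.interference α P x h i ω).toReal))) |
            MeasurableSpace.comap (TwoTier.nearestDist x i) inferInstance]
          =ᵐ[μ[|TwoTier.association α P x i]]
        fun ω => TwoTier.laplaceFormula α lam P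
          (TwoTier.exclusionRadius α P i (TwoTier.nearestDist x i ω)) s) ∧
      -- the coverage probability
      IntegrableOn (TwoTier.coverageIntegrand α σ θ lam P i) (Ioi 0) ∧
      TwoTier.coverageProb μ α σ θ P x h i =
        ∫ r in Ioi (0 : ℝ), TwoTier.coverageIntegrand α σ θ lam P i r := by
  have hassoc (i : Tier) :
      μ.real (TwoTier.association α P x i) = TwoTier.assocProb α lam P i := by
    rw [measureReal_def, TwoTier.measure_association hnet hα hlam hP,
      ENNReal.toReal_ofReal (TwoTier.assocProb_pos hlam hP i).le]
  refine ⟨hassoc .sbs, hassoc .mbs, fun i => ⟨TwoTier.map_nearestDist_cond hnet hα hlam hP i,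
    TwoTier.ae_interference_ne_top hnet hα hlam hP i,
    fun s hs => TwoTier.condExp_exp_neg_interference hnet hα hlam hP i hs, ?_⟩⟩
  have hprob := TwoTier.isProbabilityMeasure_cond_association hnet hα hlam hP i
  have hcov := TwoTier.lintegral_coverageIntegrand hnet hα hlam hP σ hθ i
  have hm := (TwoTier.aemeasurable_coverageIntegrand (lam := lam) hα hP σ hθ i).aestronglyMeasurable
  have h0 : 0 ≤ᵐ[volume.restrict (Ioi 0)] TwoTier.coverageIntegrand α σ θ lam P i := by
    filter_upwards [ae_restrict_mem measurableSet_Ioi] with r hr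
    exact TwoTier.coverageIntegrand_nonneg hlam hP σ θ i (le_of_lt hr)
  refine ⟨⟨hm, ?_⟩, ?_⟩
  -- The integral of this nonnegative function is a conditional probability, hence finite.
  · rw [hasFiniteIntegral_iff_ofReal h0, ← hcov]
    exact measure_lt_top _ _
  · rw [TwoTier.coverageProb, measureReal_def, hcov, integral_eq_lintegral_of_nonneg_ae h0 hm]
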